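/- Let $\mathcal H$ be a finite-dimensional complex Hilbert space, $\mathcal B(\mathcal H)$ the operators on it, and $\mathcal C\subset\mathcal B(\mathcal H)$ a compact convex set of positive semi-definite operators that contains at least one positive definite operator. For $1\le s<\infty$ let $\|X\|_s=(\operatorname{tr}|X|^s)^{1/s}$ be the Schatten norm, and let $\|X\|_\infty$ be the operator norm. Let $1\le q'\le p'\le\infty$, let $p,q\in[1,\infty]$ be given by $\frac1p+\frac1{p'}=1$ and $\frac1q+\frac1{q'}=1$ (so that $p\le q$), and put $\frac1r=\frac1{q'}-\frac1{p'}=\frac1p-\frac1q\in[0,1]$ (with $\frac1\infty=0$). For $X\in\mathcal B(\mathcal H)$ define $$\|X\|_{\mathcal C,p,q}=\sup_{c\in\mathcal C}\big\|c^{\frac1{2r}}Xc^{\frac1{2r}}\big\|_p,\qquad \|X\|^*_{\mathcal C,p',q'}=\inf_{c\in\mathcal C,\ c>0}\big\|c^{-\frac1{2r}}Xc^{-\frac1{2r}}\big\|_{p'} .$$ **Theorem.** For every positive semi-definite $X\in\mathcal B(\mathcal H)$, $$\sup\big\{|\operatorname{tr}[XY]| : Y\ge 0,\ \|Y\|_{\mathcal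 C,p,q}\le 1\big\}=\|X\|^*_{\mathcal C,p',q'}=\sup\big\{|\operatorname{tr}[XY]| : Y\in\mathcal B(\mathcal H),\ \|Y\|_{\mathcal C,p,q}\le 1\big\},$$ that is, on positive semi-definite operators $\|\cdot\|^*_{\mathcal C,p',q'}$ agrees with the dual norm of $\|\cdot\|_{\mathcal C,p,q}$, and the supremum may be restricted to positive semi-definite $Y$. Moreover, for all positive semi-definite $X,Y\in\mathcal B(\mathcal H)$, $$\|X+Y\|^*_{\mathcal C,p',q'}\le\|X\|^*_{\mathcal C,p',q'}+\|Y\|^*_{\mathcal C,p',q'} .$$ -/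

import Mathlib

open scoped ENNReal

section DualFormula

variable {H : Type*} [NormedAddCommGroup H] [InnerProductSpace ℂ H] [CompleteSpace H]

/-- The trace of an operator on a (finite-dimensional) Hilbert space. -/
noncomputable def opTrace (X : H →L[ℂ] H) : ℂ :=
  LinearMap.trace ℂ H (X : H →ₗ[ℂ] H)

/-- The Schatten `p`-norm `(tr |X| ^ p) ^ (1 / p)` for `1 ≤ p < ∞`, and the operator (spectral) norm
for `p = ∞`. Here `|X| = (X⋆ X) ^ (1 / 2)`, and powers are those of the functional calculus. -/
noncomputable def schattenNorm (p : ℝ≥0∞) (X : H →L[ℂ] H) : ℝ :=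
  if p = ∞ then ‖X‖ else (opTrace (CFC.abs X ^ p.toReal)).re ^ (1 / p.toReal)

/-- The number `1 / a - 1 / b` for `a, b ∈ [1, ∞]`, with `1 / ∞ = 0`. -/
noncomputable def invDiff (a b : ℝ≥0∞) : ℝ := (a⁻¹).toReal - (b⁻¹).toReal

/-- The norm `‖X‖_{C,p,q} = sup_{c ∈ C} ‖c ^ (1 / 2r) X c ^ (1 / 2r)‖_p`,
where `1 / r = 1 / p - 1 / q` and `1 ≤ p ≤ q ≤ ∞`. -/
noncomputable def supNorm (C : Set (H →L[ℂ] H)) (p q : ℝ≥0∞) (X : H →L[ℂ] H) : ℝ :=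
  sSup ((fun c : H →L[ℂ] H =>
    schattenNorm p (c ^ (invDiff p q / 2) * X * c ^ (invDiff p q / 2))) '' C)

/-- The map `‖X‖*_{C,p',q'} = inf_{c ∈ C, c > 0} ‖c ^ (-1 / 2r) X c ^ (-1 / 2r)‖_{p'}`,
where `1 / r = 1 / q' - 1 / p'` and `1 ≤ q' ≤ p' ≤ ∞`. -/
noncomputable def infNorm (C : Set (H →L[ℂ] H)) (p' q' : ℝ≥0∞) (X : H →L[ℂ] H) : ℝ :=
  sInf ((fun c : H →L[ℂ] H =>
    schattenNorm p' (c ^ (-(invDiff q' p' / 2)) * X * c ^ (-(invDiff q' p' / 2)))) ''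
      {c | c ∈ C ∧ IsStrictlyPositive c})

lemma continuous_schattenNorm [FiniteDimensional ℂ H] {p : ℝ≥0∞} (hp : 1 ≤ p) :
    Continuous (schattenNorm p : (H →L[ℂ] H) → ℝ) := by
  unfold schattenNorm
  split_ifs with h
  · exact continuous_norm
  · have h0 : 0 < p.toReal := ENNReal.toReal_pos (zero_lt_one.trans_le hp).ne' h
    have htr : Continuous (opTrace : (H →L[ℂ] H) → ℂ) :=
      LinearMap.continuous_of_finiteDimensional
        ((LinearMap.trace ℂ H) ∘ₗ (ContinuousLinearMap.coeLM ℂ : (H →L[ℂ] H) →ₗ[ℂ] _))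
    have hpow : Continuous fun X : H →L[ℂ] H => CFC.abs X ^ p.toReal :=
      Continuous.cfc_nnreal_of_mem_nhdsSet (s := Set.univ) (fun x : NNReal => x ^ p.toReal)
        Filter.univ_mem CFC.continuous_abs
        (hf := (NNReal.continuous_rpow_const h0.le).continuousOn)
        (ha' := fun X => CFC.abs_nonneg X)
    exact (Complex.continuous_re.comp (htr.comp hpow)).rpow_const
      fun _ => Or.inr (by positivity)

/-- The supremum that defines `supNorm` is a supremum of a bounded set. -/
lemma bddAbove_supNorm [FiniteDimensional ℂ H] {C : Set (H →L[ℂ] H)} (hC : IsCompact C)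
    (hC_psd : ∀ c ∈ C, 0 ≤ c) {p q : ℝ≥0∞} (hp : 1 ≤ p) (hpq : p ≤ q) (X : H →L[ℂ] H) :
    BddAbove ((fun c : H →L[ℂ] H =>
      schattenNorm p (c ^ (invDiff p q / 2) * X * c ^ (invDiff p q / 2))) '' C) := by
  have hr : 0 ≤ invDiff p q := sub_nonneg.2 <|
    ENNReal.toReal_mono (ENNReal.inv_ne_top.2 (zero_lt_one.trans_le hp).ne')
      (ENNReal.inv_le_inv.2 hpq)
  have hpow : ContinuousOn (fun c : H →L[ℂ] H => c ^ (invDiff p q / 2)) C :=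
    ContinuousOn.cfc_nnreal_of_mem_nhdsSet (s := Set.univ)
      (fun x : NNReal => x ^ (invDiff p q / 2)) Filter.univ_mem continuousOn_id
      (hf := (NNReal.continuous_rpow_const (by positivity)).continuousOn)
      (ha' := fun c hc => hC_psd c hc)
  exact (hC.image_of_continuousOn ((continuous_schattenNorm hp).comp_continuousOn
    ((hpow.mul continuousOn_const).mul hpow))).bddAbove

lemma schattenNorm_nonneg [FiniteDimensional ℂ H] (p : ℝ≥0∞) (X : H →L[ℂ] H) :
    0 ≤ schattenNorm p X := by
  unfold schattenNorm
  split_ifs with h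
  · exact norm_nonneg X
  · have h0 : (0 : H →L[ℂ] H) ≤ CFC.abs X ^ p.toReal := CFC.rpow_nonneg
    have h1 := ((ContinuousLinearMap.nonneg_iff_isPositive _).1 h0).toLinearMap.trace_nonneg
    exact Real.rpow_nonneg (Complex.le_def.1 h1).1 _

/-- The infimum that defines `infNorm` is an infimum of a set that is bounded below. -/
lemma bddBelow_infNorm [FiniteDimensional ℂ H] (C : Set (H →L[ℂ] H)) (p' q' : ℝ≥0∞)
    (X : H →L[ℂ] H) :
    BddBelow ((fun c : H →L[ℂ] H =>
      schattenNorm p' (c ^ (-(invDiff q' p' / 2)) * X * c ^ (-(invDiff q' p' / 2)))) ''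
        {c | c ∈ C ∧ IsStrictlyPositive c}) :=
  ⟨0, by rintro _ ⟨c, _, rfl⟩; exact schattenNorm_nonneg _ _⟩

end DualFormula

/-!
Write `α = 1 / r`, so that `0 ≤ α ≤ 1 / p`, and `φ_Z(c) = ‖c ^ (α / 2) Z c ^ (α / 2)‖_p`. The trace
`tr (X Y)` does not change when `X` is replaced by `c ^ (-α / 2) X c ^ (-α / 2)` and `Y` by
`c ^ (α / 2) Y c ^ (α / 2)`, so Hölder's inequality for Schatten norms (`norm_opTrace_mul_le`)
bounds the dual norm by `infNorm`.

The converse is convex duality. Its analytic input is that `c ↦ φ_Z(c)` is concave for every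
`Z ≥ 0` (`schattenNorm_rpow_conj_concave`, a form of Epstein's theorem, which is where `α ≤ 1 / p`
is needed). For `p = ∞` this forces `α = 0` and `φ_Z` is constant. For `p < ∞` and
`K = Z ^ (1 / 2)`, one has `φ_Z(c) = ‖K c ^ α K‖_p`, and duality of Schatten norms
writes this as the maximum of `tr (K c ^ α K B ^ (1 - 1 / p))` over `B ≥ 0` with `tr B ≤ 1`. By
Lieb's concavity theorem (`lieb_concavity`) this is jointly concave in `(c, B)`, and a partial
supremum of a jointly concave function is concave. Lieb's theorem in turn follows from an integral
representation of `x ^ α`: in eigenbases of `A` and `B` it turns `tr (K⋆ A ^ α K B ^ (1 - α))` into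
an integral of parallel sums, each of which is a minimum of functionals linear in `(A, B)`
(`isLeast_splitCost`); exponents with a smaller sum follow by operator concavity and monotonicity of
powers.

Concavity of `φ_Z` makes `dominatedSet`, the set of `X` such that `Re tr (X Z) ≤ φ_Z(c)` for all
`Z ≥ 0` and some positive definite `c ∈ C`, convex. If `0 < t` is below the infimum defining
`infNorm` at a positive `X`, then `t⁻¹ • X` is not in this set, and a separating functional is
`Re tr (· Y)` with `Y ≥ 0` feasible for the dual problem and `tr (X Y) ≥ t`
(`exists_nonneg_le_re_opTrace_mul`). The triangle inequality for `infNorm` is then the triangle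
inequality for a supremum of seminorms.
-/

/-! ### Eigenbases, powers and traces -/

section SpectralTools

variable {H : Type*} [NormedAddCommGroup H] [InnerProductSpace ℂ H]

lemma opTrace_eq_sum {ι : Type*} [Fintype ι] (e : OrthonormalBasis ι ℂ H) (T : H →L[ℂ] H) :
    opTrace T = ∑ i, inner ℂ (e i) (T (e i)) :=
  LinearMap.trace_eq_sum_inner _ e

lemma opTrace_add (S T : H →L[ℂ] H) : opTrace (S + T) = opTrace S + opTrace T := by
  simp [opTrace]

lemma opTrace_smul (z : ℂ) (T : H →L[ℂ] H) : opTrace (z • T) = z * opTrace T := by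
  simp [opTrace]

lemma opTrace_mul_comm (S T : H →L[ℂ] H) : opTrace (S * T) = opTrace (T * S) :=
  LinearMap.trace_mul_comm ℂ (S : H →ₗ[ℂ] H) T

lemma re_opTrace_nonneg {A : H →L[ℂ] H} (hA : 0 ≤ A) : 0 ≤ (opTrace A).re := by
  have h := ((ContinuousLinearMap.nonneg_iff_isPositive _).1 hA).toLinearMap.trace_nonneg
  exact (Complex.le_def.1 h).1

variable [CompleteSpace H]

lemma rpow_add_of_nonneg (A : H →L[ℂ] H) {s t : ℝ} (hs : 0 ≤ s) (ht : 0 ≤ t) :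
    A ^ (s + t) = A ^ s * A ^ t := by
  rw [CFC.rpow_def, CFC.rpow_def, CFC.rpow_def, ← cfc_mul _ _ A
    (NNReal.continuous_rpow_const hs).continuousOn (NNReal.continuous_rpow_const ht).continuousOn]
  refine cfc_congr fun x _ => ?_
  exact NNReal.rpow_add_of_nonneg x hs ht

lemma re_opTrace_mul_nonneg {A B : H →L[ℂ] H} (hA : 0 ≤ A) (hB : 0 ≤ B) :
    0 ≤ (opTrace (A * B)).re := by
  have h : A = A ^ (1 / 2 : ℝ) * A ^ (1 / 2 : ℝ) := by
    rw [← CFC.sqrt_eq_rpow, CFC.sqrt_mul_sqrt_self A hA]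
  rw [h, mul_assoc, opTrace_mul_comm]
  refine re_opTrace_nonneg ?_
  exact (IsSelfAdjoint.of_nonneg CFC.rpow_nonneg).conjugate_nonneg hB

variable [FiniteDimensional ℂ H]

/-- An eigenvector of `A ≥ 0` is an eigenvector of every real power of `A`. -/
lemma rpow_apply_of_apply_eq_smul {A : H →L[ℂ] H} (hA : 0 ≤ A) {v : H} (hv : v ≠ 0) {a : ℝ}
    (h : A v = (a : ℂ) • v) (s : ℝ) : (A ^ s) v = ((a ^ s : ℝ) : ℂ) • v := by
  have hsa : IsSelfAdjoint A := .of_nonneg hA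
  have hev : Module.End.HasEigenvector (A : H →ₗ[ℂ] H) (a : ℂ) v :=
    ⟨Module.End.mem_eigenspace_iff.2 h, hv⟩
  have hmem : a ∈ spectrum ℝ A := by
    rw [← spectrum.algebraMap_mem_iff ℂ]
    have h1 := (Module.End.hasEigenvalue_of_hasEigenvector hev).mem_spectrum
    rw [← ContinuousLinearMap.spectrum_eq] at h1
    exact h1
  have hfin : (spectrum ℝ A).Finite := by
    have h1 : (spectrum ℂ A).Finite := by
      rw [ContinuousLinearMap.spectrum_eq]
      exact Module.End.finite_spectrum _
    refine Set.Finite.of_finite_image (f := ((↑) : ℝ → ℂ)) (h1.subset ?_)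
      Complex.ofReal_injective.injOn
    rintro _ ⟨x, hx, rfl⟩
    exact (spectrum.algebraMap_mem_iff ℂ).2 hx
  -- The spectrum is finite, so the power is a polynomial in `A`.
  let q : Polynomial ℝ := Lagrange.interpolate hfin.toFinset id fun x => x ^ s
  have hq : ∀ x ∈ spectrum ℝ A, q.eval x = x ^ s := fun x hx =>
    Lagrange.eval_interpolate_at_node (v := id) (fun x : ℝ => x ^ s)
      Function.injective_id.injOn (hfin.mem_toFinset.2 hx)
  have hpow : A ^ s = Polynomial.aeval A q := by
    rw [CFC.rpow_eq_cfc_real hA, ← cfc_polynomial q A]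
    exact cfc_congr fun x hx => (hq x hx).symm
  have haev : (Polynomial.aeval A q) v = ((q.eval a : ℝ) : ℂ) • v := by
    clear_value q
    clear hq hpow
    induction q using Polynomial.induction_on' with
    | add q r hq hr => simp [hq, hr, add_smul]
    | monomial n c =>
      have hn : ∀ n : ℕ, (A ^ n) v = ((a : ℂ) ^ n) • v := by
        intro n
        induction n with
        | zero => simp
        | succ n ih => rw [pow_succ', mul_apply_eq_comp, ih, map_smul, h, smul_smul,
            pow_succ]
      simp [Polynomial.aeval_monomial, hn, Algebra.algebraMap_eq_smul_one, ← smul_smul]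
  rw [hpow, haev, hq a hmem]

/-- The spectral theorem for a positive operator and all of its real powers at once. -/
lemma exists_eigenbasis {A : H →L[ℂ] H} (hA : 0 ≤ A) :
    ∃ (e : OrthonormalBasis (Fin (Module.finrank ℂ H)) ℂ H) (a : Fin (Module.finrank ℂ H) → ℝ),
      (∀ i, 0 ≤ a i) ∧ ∀ (s : ℝ) i, (A ^ s) (e i) = ((a i ^ s : ℝ) : ℂ) • e i := by
  have hpos := ((ContinuousLinearMap.nonneg_iff_isPositive _).1 hA).toLinearMap
  refine ⟨hpos.isSymmetric.eigenvectorBasis rfl, hpos.isSymmetric.eigenvalues rfl,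
    hpos.nonneg_eigenvalues rfl, fun s i => ?_⟩
  exact rpow_apply_of_apply_eq_smul hA
    ((hpos.isSymmetric.eigenvectorBasis rfl).orthonormal.ne_zero i)
    (hpos.isSymmetric.apply_eigenvectorBasis rfl i) s

/-- Powers of `S * T` and of `T * S` have the same trace, since both products have the same
characteristic polynomial. -/
lemma opTrace_rpow_mul_comm {S T : H →L[ℂ] H} (h : 0 ≤ S * T) (h' : 0 ≤ T * S) (s : ℝ) :
    opTrace ((S * T) ^ s) = opTrace ((T * S) ^ s) := by
  have key : ∀ {A : H →L[ℂ] H} (hA : 0 ≤ A), opTrace (A ^ s) = ∑ i,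
      (((((ContinuousLinearMap.nonneg_iff_isPositive _).1 hA).toLinearMap.isSymmetric.eigenvalues
        rfl i) ^ s : ℝ) : ℂ) := by
    intro A hA
    have hpos := ((ContinuousLinearMap.nonneg_iff_isPositive _).1 hA).toLinearMap
    rw [opTrace_eq_sum (hpos.isSymmetric.eigenvectorBasis rfl)]
    refine Finset.sum_congr rfl fun i _ => ?_
    rw [rpow_apply_of_apply_eq_smul hA (a := hpos.isSymmetric.eigenvalues rfl i)
      ((hpos.isSymmetric.eigenvectorBasis rfl).orthonormal.ne_zero i)
      (hpos.isSymmetric.apply_eigenvectorBasis rfl i) s, inner_smul_right,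
      OrthonormalBasis.inner_eq_one, mul_one]
  rw [key h, key h']
  have hchar : ((S * T : H →L[ℂ] H) : H →ₗ[ℂ] H).charpoly
      = ((T * S : H →L[ℂ] H) : H →ₗ[ℂ] H).charpoly := by
    let b := Module.finBasis ℂ H
    rw [← LinearMap.charpoly_toMatrix _ b, ← LinearMap.charpoly_toMatrix _ b]
    change (LinearMap.toMatrix b b ((S : H →ₗ[ℂ] H) * (T : H →ₗ[ℂ] H))).charpoly
      = (LinearMap.toMatrix b b ((T : H →ₗ[ℂ] H) * (S : H →ₗ[ℂ] H))).charpoly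
    rw [LinearMap.toMatrix_mul, LinearMap.toMatrix_mul, Matrix.charpoly_mul_comm]
  rw [(LinearMap.IsSymmetric.eigenvalues_eq_eigenvalues_iff _ rfl _ rfl).2 hchar]

end SpectralTools

/-! ### Hölder's inequality for Schatten norms -/

section Schatten

/-- Hölder's inequality for a bilinear form whose coefficients have row and column sums at most
one. -/
lemma sum_mul_mul_le_Lp_mul_Lq {ι κ : Type*} [Fintype ι] [Fintype κ] {p q : ℝ}
    (hpq : p.HolderConjugate q) {a : ι → ℝ} {s : κ → ℝ} {w : ι → κ → ℝ} (ha : ∀ i, 0 ≤ a i)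
    (hs : ∀ k, 0 ≤ s k) (hw : ∀ i k, 0 ≤ w i k) (hrow : ∀ i, ∑ k, w i k ≤ 1)
    (hcol : ∀ k, ∑ i, w i k ≤ 1) :
    ∑ i, ∑ k, a i * s k * w i k ≤ (∑ i, a i ^ p) ^ (1 / p) * (∑ k, s k ^ q) ^ (1 / q) := by
  have hp := hpq.pos
  have hq := hpq.symm.pos
  have h := Real.inner_le_Lp_mul_Lq_of_nonneg (Finset.univ : Finset (ι × κ)) hpq
    (f := fun x => a x.1 * w x.1 x.2 ^ (1 / p)) (g := fun x => s x.2 * w x.1 x.2 ^ (1 / q))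
    (fun x _ => mul_nonneg (ha _) (Real.rpow_nonneg (hw _ _) _))
    (fun x _ => mul_nonneg (hs _) (Real.rpow_nonneg (hw _ _) _))
  have hpow : ∀ {r : ℝ}, 0 < r → ∀ {x y : ℝ}, 0 ≤ x → 0 ≤ y →
      (x * y ^ (1 / r)) ^ r = x ^ r * y := by
    intro r hr x y hx hy
    rw [Real.mul_rpow hx (Real.rpow_nonneg hy _), ← Real.rpow_mul hy, one_div,
      inv_mul_cancel₀ hr.ne', Real.rpow_one]
  have hone : 1 / p + 1 / q = 1 := by simpa using hpq.inv_add_inv_eq_one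
  have hlhs : ∀ x : ι × κ, a x.1 * w x.1 x.2 ^ (1 / p) * (s x.2 * w x.1 x.2 ^ (1 / q))
      = a x.1 * s x.2 * w x.1 x.2 := by
    intro x
    have : w x.1 x.2 = w x.1 x.2 ^ (1 / p) * w x.1 x.2 ^ (1 / q) := by
      rw [← Real.rpow_add_of_nonneg (hw _ _) (by positivity) (by positivity), hone, Real.rpow_one]
    conv_rhs => rw [this]
    ring
  simp only [hlhs, hpow hp (ha _) (hw _ _), hpow hq (hs _) (hw _ _)] at h
  rw [Fintype.sum_prod_type, Fintype.sum_prod_type, Fintype.sum_prod_type_right] at h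
  dsimp only at h
  refine h.trans (mul_le_mul ?_ ?_ ?_ ?_)
  · refine Real.rpow_le_rpow ?_ ?_ (by positivity)
    · exact Finset.sum_nonneg fun i _ => Finset.sum_nonneg fun k _ =>
        mul_nonneg (Real.rpow_nonneg (ha _) _) (hw _ _)
    · refine Finset.sum_le_sum fun i _ => ?_
      rw [← Finset.mul_sum]
      exact mul_le_of_le_one_right (Real.rpow_nonneg (ha _) _) (hrow i)
  · refine Real.rpow_le_rpow ?_ ?_ (by positivity)
    · exact Finset.sum_nonneg fun i _ => Finset.sum_nonneg fun k _ =>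
        mul_nonneg (Real.rpow_nonneg (hs _) _) (hw _ _)
    · refine Finset.sum_le_sum fun k _ => ?_
      rw [← Finset.mul_sum]
      exact mul_le_of_le_one_right (Real.rpow_nonneg (hs _) _) (hcol k)
  · exact Real.rpow_nonneg (Finset.sum_nonneg fun k _ => Finset.sum_nonneg fun i _ =>
      mul_nonneg (Real.rpow_nonneg (hs _) _) (hw _ _)) _
  · exact Real.rpow_nonneg (Finset.sum_nonneg fun i _ => Real.rpow_nonneg (ha _) _) _

variable {H : Type*} [NormedAddCommGroup H] [InnerProductSpace ℂ H] [CompleteSpace H]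

lemma schattenNorm_top (X : H →L[ℂ] H) : schattenNorm ∞ X = ‖X‖ := if_pos rfl

lemma schattenNorm_of_nonneg {p : ℝ≥0∞} (hp : p ≠ ∞) {A : H →L[ℂ] H} (hA : 0 ≤ A) :
    schattenNorm p A = (opTrace (A ^ p.toReal)).re ^ (1 / p.toReal) := by
  rw [schattenNorm, if_neg hp, CFC.abs_of_nonneg A hA]

lemma schattenNorm_one_of_nonneg {A : H →L[ℂ] H} (hA : 0 ≤ A) :
    schattenNorm 1 A = (opTrace A).re := by
  rw [schattenNorm_of_nonneg ENNReal.one_ne_top hA]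
  simp [CFC.rpow_one A hA]

lemma re_opTrace_rpow_eq_sum {ι : Type*} [Fintype ι] {A : H →L[ℂ] H}
    {e : OrthonormalBasis ι ℂ H} {a : ι → ℝ}
    (hA : ∀ (s : ℝ) i, (A ^ s) (e i) = ((a i ^ s : ℝ) : ℂ) • e i) (s : ℝ) :
    (opTrace (A ^ s)).re = ∑ i, a i ^ s := by
  rw [opTrace_eq_sum e, Complex.re_sum]
  refine Finset.sum_congr rfl fun i _ => ?_
  rw [hA, inner_smul_right, OrthonormalBasis.inner_eq_one, mul_one, Complex.ofReal_re]

variable [FiniteDimensional ℂ H]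

/-- Singular value bound: `|tr (A B)| ≤ ∑ aᵢ sₖ wᵢₖ` where `aᵢ` are the eigenvalues of `A`, `sₖ` the
singular values of `B`, and `w` has row and column sums at most one. -/
lemma exists_norm_opTrace_mul_le {A : H →L[ℂ] H} (hA : 0 ≤ A) (B : H →L[ℂ] H) :
    ∃ (a s : Fin (Module.finrank ℂ H) → ℝ)
      (w : Fin (Module.finrank ℂ H) → Fin (Module.finrank ℂ H) → ℝ),
      (∀ i, 0 ≤ a i ∧ a i ≤ ‖A‖) ∧ (∀ k, 0 ≤ s k ∧ s k ≤ ‖B‖) ∧ (∀ i k, 0 ≤ w i k) ∧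
      (∀ i, ∑ k, w i k ≤ 1) ∧ (∀ k, ∑ i, w i k ≤ 1) ∧
      (∀ r : ℝ≥0∞, r ≠ ∞ → schattenNorm r A = (∑ i, a i ^ r.toReal) ^ (1 / r.toReal)) ∧
      (∀ r : ℝ≥0∞, r ≠ ∞ → schattenNorm r B = (∑ k, s k ^ r.toReal) ^ (1 / r.toReal)) ∧
      ‖opTrace (A * B)‖ ≤ ∑ i, ∑ k, a i * s k * w i k := by
  obtain ⟨e, a, ha0, ha⟩ := exists_eigenbasis hA
  obtain ⟨g, s, hs0, hs⟩ := exists_eigenbasis (CFC.abs_nonneg B)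
  have hae : ∀ i, A (e i) = (a i : ℂ) • e i := fun i => by
    simpa [CFC.rpow_one A hA] using ha 1 i
  have hsg : ∀ k, CFC.abs B (g k) = (s k : ℂ) • g k := fun k => by
    simpa [CFC.rpow_one (CFC.abs B) (CFC.abs_nonneg B)] using hs 1 k
  have hBB : ∀ k l, inner ℂ (B (g k)) (B (g l)) = (s k * s l : ℂ) * inner ℂ (g k) (g l) := by
    intro k l
    have h1 : inner ℂ (B (g k)) (B (g l)) = inner ℂ (g k) ((star B * B) (g l)) := by
      rw [mul_apply_eq_comp, ContinuousLinearMap.star_eq_adjoint,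
        ContinuousLinearMap.adjoint_inner_right]
    have h2 : inner ℂ (g k) ((CFC.abs B * CFC.abs B) (g l))
        = inner ℂ (CFC.abs B (g k)) (CFC.abs B (g l)) := by
      rw [mul_apply_eq_comp]
      nth_rewrite 1 [← (IsSelfAdjoint.of_nonneg (CFC.abs_nonneg B)).star_eq]
      rw [ContinuousLinearMap.star_eq_adjoint, ContinuousLinearMap.adjoint_inner_right]
    rw [h1, ← CFC.abs_mul_abs, h2, hsg, hsg, inner_smul_left, inner_smul_right,
      Complex.conj_ofReal]
    ring
  -- The left singular vectors; they vanish where the singular value does.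
  let u : Fin (Module.finrank ℂ H) → H := fun k => ((s k)⁻¹ : ℂ) • B (g k)
  have hnB : ∀ k, ‖B (g k)‖ = s k := by
    intro k
    have h1 := hBB k k
    rw [OrthonormalBasis.inner_eq_one, mul_one, inner_self_eq_norm_sq_to_K] at h1
    have h2 : ‖B (g k)‖ ^ 2 = s k ^ 2 := by
      rw [sq (s k)]
      have h3 : ((‖B (g k)‖ ^ 2 : ℝ) : ℂ) = ((s k * s k : ℝ) : ℂ) := by push_cast; exact h1
      exact Complex.ofReal_injective h3
    exact (pow_left_inj₀ (norm_nonneg _) (hs0 k) two_ne_zero).1 h2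
  have hBu : ∀ k, B (g k) = (s k : ℂ) • u k := by
    intro k
    by_cases h : s k = 0
    · have := hnB k
      rw [h, norm_eq_zero] at this
      rw [this, h]; simp
    · rw [smul_smul, mul_inv_cancel₀ (by exact_mod_cast h), one_smul]
  have hun : ∀ k, ‖u k‖ ≤ 1 := by
    intro k
    rw [norm_smul, hnB, norm_inv, Complex.norm_real, Real.norm_of_nonneg (hs0 k)]
    exact inv_mul_le_one
  have horth : Orthonormal ℂ fun k : {k // s k ≠ 0} => u k := by
    rw [orthonormal_iff_ite]
    rintro ⟨k, hk⟩ ⟨l, hl⟩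
    have hk' : (s k : ℂ) ≠ 0 := by exact_mod_cast hk
    have hl' : (s l : ℂ) ≠ 0 := by exact_mod_cast hl
    simp only [u, inner_smul_left, inner_smul_right, hBB, g.inner_eq_ite, Subtype.mk.injEq,
      map_inv₀, Complex.conj_ofReal]
    split_ifs with h
    · field_simp
    · simp
  have hbessel : ∀ x : H, ∑ k, ‖inner ℂ x (u k)‖ ^ 2 ≤ ‖x‖ ^ 2 := by
    intro x
    have h1 := horth.sum_inner_products_le x (s := Finset.univ)
    have h2 : ∑ k, ‖inner ℂ x (u k)‖ ^ 2
        = ∑ k : {k // s k ≠ 0}, ‖inner ℂ (u k) x‖ ^ 2 := by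
      rw [← Finset.sum_subtype (Finset.univ.filter fun k => s k ≠ 0) (by simp)
        fun k => ‖inner ℂ (u k) x‖ ^ 2]
      simp_rw [norm_inner_symm x]
      refine (Finset.sum_filter_of_ne (p := fun k => s k ≠ 0) fun k _ hk hsk => hk ?_).symm
      simp [u, hsk]
    rw [h2]; exact h1
  refine ⟨a, s, fun i k => (‖inner ℂ (g k) (e i)‖ ^ 2 + ‖inner ℂ (e i) (u k)‖ ^ 2) / 2,
    fun i => ⟨ha0 i, ?_⟩, fun k => ⟨hs0 k, ?_⟩, fun i k => by positivity, fun i => ?_, fun k => ?_,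
    fun r hr => ?_, fun r hr => ?_, ?_⟩
  · have := A.le_opNorm (e i)
    rwa [hae, norm_smul, e.norm_eq_one, mul_one, mul_one, Complex.norm_real,
      Real.norm_of_nonneg (ha0 i)] at this
  · have := B.le_opNorm (g k)
    rwa [hnB, g.norm_eq_one, mul_one] at this
  · rw [← Finset.sum_div, Finset.sum_add_distrib, g.sum_sq_norm_inner_right, e.norm_eq_one]
    have := hbessel (e i)
    rw [e.norm_eq_one] at this
    linarith
  · rw [← Finset.sum_div, Finset.sum_add_distrib, e.sum_sq_norm_inner_right,
      e.sum_sq_norm_inner_left, g.norm_eq_one]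
    have := pow_le_one₀ (n := 2) (norm_nonneg _) (hun k)
    linarith
  · rw [schattenNorm_of_nonneg hr hA, re_opTrace_rpow_eq_sum ha]
  · rw [schattenNorm, if_neg hr, re_opTrace_rpow_eq_sum hs]
  · have htr : opTrace (A * B) = ∑ k, ∑ i,
        (a i * s k : ℂ) * (inner ℂ (g k) (e i) * inner ℂ (e i) (u k)) := by
      rw [opTrace_eq_sum g]
      refine Finset.sum_congr rfl fun k _ => ?_
      have h1 : inner ℂ (g k) ((A * B) (g k)) = inner ℂ (A (g k)) (B (g k)) := by
        rw [mul_apply_eq_comp]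
        nth_rewrite 1 [← (IsSelfAdjoint.of_nonneg hA).star_eq]
        rw [ContinuousLinearMap.star_eq_adjoint, ContinuousLinearMap.adjoint_inner_right]
      rw [h1, ← e.sum_inner_mul_inner]
      refine Finset.sum_congr rfl fun i _ => ?_
      have h2 : inner ℂ (A (g k)) (e i) = inner ℂ (g k) (A (e i)) := by
        nth_rewrite 1 [← (IsSelfAdjoint.of_nonneg hA).star_eq]
        rw [ContinuousLinearMap.star_eq_adjoint, ContinuousLinearMap.adjoint_inner_left]
      rw [h2, hae, hBu, inner_smul_right, inner_smul_right]
      ring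
    rw [htr, Finset.sum_comm]
    refine (norm_sum_le _ _).trans (Finset.sum_le_sum fun i _ => ?_)
    refine (norm_sum_le _ _).trans (Finset.sum_le_sum fun k _ => ?_)
    rw [norm_mul, norm_mul, norm_mul, Complex.norm_real, Complex.norm_real,
      Real.norm_of_nonneg (ha0 i), Real.norm_of_nonneg (hs0 k)]
    -- `x y ≤ (x ^ 2 + y ^ 2) / 2` produces weights whose sums are controlled by Bessel's inequality.
    refine mul_le_mul_of_nonneg_left ?_ (mul_nonneg (ha0 i) (hs0 k))
    nlinarith [sq_nonneg (‖inner ℂ (g k) (e i)‖ - ‖inner ℂ (e i) (u k)‖)]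

/-- Hölder's inequality for Schatten norms, with one positive factor. -/
lemma norm_opTrace_mul_le {p p' : ℝ≥0∞} (hp : p⁻¹ + p'⁻¹ = 1) {A : H →L[ℂ] H} (hA : 0 ≤ A)
    (B : H →L[ℂ] H) : ‖opTrace (A * B)‖ ≤ schattenNorm p' A * schattenNorm p B := by
  obtain ⟨a, s, w, ha, hs, hw, hrow, hcol, hnA, hnB, htr⟩ := exists_norm_opTrace_mul_le hA B
  refine htr.trans ?_
  by_cases hpt : p = ∞
  · have hp1 : p' = 1 := by simpa [hpt] using hp
    rw [hpt, schattenNorm_top, hp1, hnA 1 ENNReal.one_ne_top]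
    simp only [ENNReal.toReal_one, Real.rpow_one, one_div, inv_one, Finset.sum_mul]
    refine Finset.sum_le_sum fun i _ => ?_
    calc ∑ k, a i * s k * w i k ≤ ∑ k, a i * ‖B‖ * w i k := Finset.sum_le_sum fun k _ =>
          mul_le_mul_of_nonneg_right (mul_le_mul_of_nonneg_left (hs k).2 (ha i).1) (hw i k)
      _ = a i * ‖B‖ * ∑ k, w i k := by rw [Finset.mul_sum]
      _ ≤ a i * ‖B‖ := mul_le_of_le_one_right (mul_nonneg (ha i).1 (norm_nonneg _)) (hrow i)
  by_cases hpt' : p' = ∞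
  · have hp1 : p = 1 := by simpa [hpt'] using hp
    rw [hpt', schattenNorm_top, hp1, hnB 1 ENNReal.one_ne_top, Finset.sum_comm]
    simp only [ENNReal.toReal_one, Real.rpow_one, one_div, inv_one, Finset.mul_sum]
    refine Finset.sum_le_sum fun k _ => ?_
    calc ∑ i, a i * s k * w i k ≤ ∑ i, ‖A‖ * s k * w i k := Finset.sum_le_sum fun i _ =>
          mul_le_mul_of_nonneg_right (mul_le_mul_of_nonneg_right (ha i).2 (hs k).1) (hw i k)
      _ = ‖A‖ * s k * ∑ i, w i k := by rw [Finset.mul_sum]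
      _ ≤ ‖A‖ * s k := mul_le_of_le_one_right (mul_nonneg (norm_nonneg _) (hs k).1) (hcol k)
  · rw [hnA p' hpt', hnB p hpt]
    have hpp : p.HolderConjugate p' := ⟨by rw [hp, inv_one]⟩
    have hconj := (ENNReal.HolderConjugate.toReal_of_ne_top hpt hpt').symm
    exact sum_mul_mul_le_Lp_mul_Lq hconj (fun i => (ha i).1) (fun k => (hs k).1) hw hrow hcol

end Schatten

/-! ### Duality of Schatten norms -/

section Duality

variable {H : Type*} [NormedAddCommGroup H] [InnerProductSpace ℂ H]

lemma one_le_of_inv_add_inv_eq_one {p p' : ℝ≥0∞} (hp : p⁻¹ + p'⁻¹ = 1) : 1 ≤ p :=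
  ENNReal.inv_le_one.1 (hp ▸ le_self_add)

lemma nonneg_rankOne_self [CompleteSpace H] (v : H) : 0 ≤ InnerProductSpace.rankOne ℂ v v :=
  (ContinuousLinearMap.nonneg_iff_isPositive _).2 (InnerProductSpace.isPositive_rankOne_self v)

lemma opTrace_mul_rankOne [FiniteDimensional ℂ H] (A : H →L[ℂ] H) (v w : H) :
    opTrace (A * InnerProductSpace.rankOne ℂ v w) = inner ℂ w (A v) := by
  have h : A * InnerProductSpace.rankOne ℂ v w = InnerProductSpace.rankOne ℂ (A v) w := by
    ext x
    simp [InnerProductSpace.rankOne_apply]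
  rw [h]
  exact InnerProductSpace.trace_rankOne _ _

variable [CompleteSpace H]

lemma schattenNorm_zero {p : ℝ≥0∞} (hp : 1 ≤ p) : schattenNorm p (0 : H →L[ℂ] H) = 0 := by
  by_cases hpt : p = ∞
  · rw [hpt, schattenNorm_top, norm_zero]
  · have hr : 0 < p.toReal := ENNReal.toReal_pos (zero_lt_one.trans_le hp).ne' hpt
    have hz : (0 : H →L[ℂ] H) ^ p.toReal = 0 := by
      rw [CFC.rpow_eq_cfc_real le_rfl, cfc_apply_zero, Real.zero_rpow hr.ne', map_zero]
    rw [schattenNorm_of_nonneg hpt le_rfl, hz]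
    simp [opTrace, hr.ne']

/-- If `B` has trace at most one, then `B ^ (1 - 1 / p)` lies in the unit ball of the dual norm. For
`p = 1` the power is the identity, also when `B` is singular. -/
lemma schattenNorm_rpow_le_one {p p' : ℝ≥0∞} (hp : p⁻¹ + p'⁻¹ = 1) (hpt : p ≠ ∞)
    {B : H →L[ℂ] H} (hB : 0 ≤ B) (htr : (opTrace B).re ≤ 1) :
    schattenNorm p' (B ^ (1 - 1 / p.toReal)) ≤ 1 := by
  by_cases hpt' : p' = ∞
  · have hp1 : p = 1 := by simpa [hpt'] using hp
    simp only [hpt', schattenNorm_top, hp1, ENNReal.toReal_one, div_one, sub_self,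
      CFC.rpow_zero B hB]
    exact ContinuousLinearMap.norm_id_le
  · have hpp : p.HolderConjugate p' := ⟨by rw [hp, inv_one]⟩
    have hconj := ENNReal.HolderConjugate.toReal_of_ne_top hpt hpt'
    have hexp : (1 - 1 / p.toReal) * p'.toReal = 1 := by
      rw [one_div, sub_eq_of_eq_add' hconj.inv_add_inv_eq_one.symm,
        inv_mul_cancel₀ hconj.symm.pos.ne']
    have hexp0 : 0 ≤ 1 - 1 / p.toReal := by
      rw [one_div, sub_eq_of_eq_add' hconj.inv_add_inv_eq_one.symm]
      exact inv_nonneg.2 hconj.symm.nonneg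
    have hpow : (B ^ (1 - 1 / p.toReal)) ^ p'.toReal = B := by
      rw [CFC.rpow_rpow_of_exponent_nonneg B (1 - 1 / p.toReal) p'.toReal hexp0 hconj.symm.nonneg,
        hexp, CFC.rpow_one B hB]
    have hW : 0 ≤ B ^ (1 - 1 / p.toReal) := CFC.rpow_nonneg
    rw [schattenNorm_of_nonneg hpt' hW, hpow]
    exact Real.rpow_le_one (re_opTrace_nonneg hB) htr (by positivity)

variable [FiniteDimensional ℂ H]

/-- The Schatten norm of a positive operator is a supremum of traces against `B ^ (1 - 1 / p)`
over density operators `B`; this gives the upper bound. -/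
lemma re_opTrace_mul_rpow_le {p p' : ℝ≥0∞} (hp : p⁻¹ + p'⁻¹ = 1) (hpt : p ≠ ∞)
    {A B : H →L[ℂ] H} (hA : 0 ≤ A) (hB : 0 ≤ B) (htr : (opTrace B).re ≤ 1) :
    (opTrace (A * B ^ (1 - 1 / p.toReal))).re ≤ schattenNorm p A := by
  refine (Complex.re_le_norm _).trans ?_
  refine (norm_opTrace_mul_le (by rwa [add_comm] : p'⁻¹ + p⁻¹ = 1) hA _).trans ?_
  exact mul_le_of_le_one_right (schattenNorm_nonneg _ _) (schattenNorm_rpow_le_one hp hpt hB htr)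

/-- The bound `re_opTrace_mul_rpow_le` is attained, at the normalization of `A ^ p`. -/
lemma exists_re_opTrace_mul_rpow_eq {p : ℝ≥0∞} (hp : 1 ≤ p) (hpt : p ≠ ∞)
    {A : H →L[ℂ] H} (hA : 0 ≤ A) :
    ∃ B : H →L[ℂ] H, 0 ≤ B ∧ (opTrace B).re ≤ 1 ∧
      (opTrace (A * B ^ (1 - 1 / p.toReal))).re = schattenNorm p A := by
  have hp1 : 1 ≤ p.toReal := by
    simpa using ENNReal.toReal_mono hpt hp
  have hp0 : 0 < p.toReal := by linarith
  obtain ⟨e, a, ha0, ha⟩ := exists_eigenbasis hA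
  set t : ℝ := (opTrace (A ^ p.toReal)).re with ht
  have hts : t = ∑ i, a i ^ p.toReal := re_opTrace_rpow_eq_sum ha _
  have ht0 : 0 ≤ t := re_opTrace_nonneg CFC.rpow_nonneg
  have hB : 0 ≤ t⁻¹ • A ^ p.toReal := smul_nonneg (by positivity) CFC.rpow_nonneg
  refine ⟨t⁻¹ • A ^ p.toReal, hB, ?_, ?_⟩
  · rw [← Complex.coe_smul, opTrace_smul, Complex.re_ofReal_mul, ← ht]
    exact inv_mul_le_one
  · have hBe : ∀ i, (t⁻¹ • A ^ p.toReal) (e i) = ((t⁻¹ * a i ^ p.toReal : ℝ) : ℂ) • e i := by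
      intro i
      rw [smul_apply, ha, ← Complex.coe_smul, smul_smul]
      push_cast
      rfl
    have hAe : ∀ i, A (e i) = (a i : ℂ) • e i := fun i => by
      simpa [CFC.rpow_one A hA] using ha 1 i
    have hterm : ∀ i, (inner ℂ (e i) ((A * (t⁻¹ • A ^ p.toReal) ^ (1 - 1 / p.toReal)) (e i))).re
        = a i * (t⁻¹ * a i ^ p.toReal) ^ (1 - 1 / p.toReal) := by
      intro i
      rw [mul_apply_eq_comp, rpow_apply_of_apply_eq_smul hB (e.orthonormal.ne_zero i) (hBe i),
        map_smul, hAe, smul_smul, inner_smul_right, OrthonormalBasis.inner_eq_one, mul_one,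
        ← Complex.ofReal_mul, Complex.ofReal_re, mul_comm]
    rw [schattenNorm_of_nonneg hpt hA, ← ht, opTrace_eq_sum e, Complex.re_sum]
    simp only [hterm]
    -- If `tr (A ^ p) = 0`, then `A = 0`, and the normalization is `0` since `t⁻¹ = 0`.
    rcases ht0.eq_or_lt with h0 | h0
    · have hz : ∀ i, a i = 0 := by
        intro i
        have h1 := (Finset.sum_eq_zero_iff_of_nonneg
          fun i _ => Real.rpow_nonneg (ha0 i) _).1 (hts.symm.trans h0.symm) i (Finset.mem_univ i)
        exact ((Real.rpow_eq_zero (ha0 i) hp0.ne').1 h1)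
      rw [← h0, Real.zero_rpow (by positivity)]
      exact Finset.sum_eq_zero fun i _ => by rw [hz i, zero_mul]
    · have h1 : ∀ i, a i * (t⁻¹ * a i ^ p.toReal) ^ (1 - 1 / p.toReal)
          = t⁻¹ ^ (1 - 1 / p.toReal) * a i ^ p.toReal := by
        intro i
        rw [Real.mul_rpow (by positivity) (Real.rpow_nonneg (ha0 i) _), ← Real.rpow_mul (ha0 i),
          mul_sub, mul_one, mul_one_div_cancel hp0.ne']
        have : a i ^ p.toReal = a i * a i ^ (p.toReal - 1) := by
          conv_lhs => rw [← add_sub_cancel 1 p.toReal,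
            Real.rpow_add_of_nonneg (ha0 i) zero_le_one (by linarith), Real.rpow_one]
        rw [this]; ring
      simp only [h1]
      rw [← Finset.mul_sum, ← hts, Real.inv_rpow ht0, Real.rpow_sub h0, Real.rpow_one]
      have := (Real.rpow_pos_of_pos h0 (1 / p.toReal)).ne'
      field_simp

/-- The Schatten norm of a positive operator is attained by duality at a positive operator. -/
lemma exists_re_opTrace_mul_eq_schattenNorm {p p' : ℝ≥0∞} (hp : p⁻¹ + p'⁻¹ = 1)
    {A : H →L[ℂ] H} (hA : 0 ≤ A) :
    ∃ W : H →L[ℂ] H, 0 ≤ W ∧ schattenNorm p W ≤ 1 ∧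
      (opTrace (A * W)).re = schattenNorm p' A := by
  have hp' : p'⁻¹ + p⁻¹ = 1 := by rwa [add_comm]
  by_cases hpt' : p' = ∞
  · have hp1 : p = 1 := by simpa [hpt'] using hp
    rw [hpt', hp1, schattenNorm_top]
    rcases subsingleton_or_nontrivial H with hH | hH
    · refine ⟨0, le_rfl, ?_, ?_⟩
      · rw [schattenNorm_one_of_nonneg le_rfl]; simp [opTrace]
      · simp [opTrace, Subsingleton.elim A 0]
    · have h1 : ‖A‖ ∈ spectrum ℝ A := CStarAlgebra.norm_mem_spectrum_of_nonneg hA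
      rw [← spectrum.algebraMap_mem_iff ℂ, ContinuousLinearMap.spectrum_eq,
        ← Module.End.hasEigenvalue_iff_mem_spectrum] at h1
      obtain ⟨v, hv⟩ := h1.exists_hasEigenvector
      have hAv : A v = (‖A‖ : ℂ) • v := hv.apply_eq_smul
      have hu : ‖(‖v‖⁻¹ : ℂ) • v‖ = 1 := by
        rw [norm_smul, norm_inv, Complex.norm_real, norm_norm,
          inv_mul_cancel₀ (norm_ne_zero_iff.2 hv.2)]
      have hAu : A ((‖v‖⁻¹ : ℂ) • v) = (‖A‖ : ℂ) • (‖v‖⁻¹ : ℂ) • v := by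
        rw [map_smul, hAv, smul_comm]
      generalize (‖v‖⁻¹ : ℂ) • v = u at hu hAu
      refine ⟨InnerProductSpace.rankOne ℂ u u, nonneg_rankOne_self _, ?_, ?_⟩
      · rw [schattenNorm_one_of_nonneg (nonneg_rankOne_self _)]
        have h2 := opTrace_mul_rankOne 1 u u
        rw [one_mul, one_apply_eq_self, inner_self_eq_one_of_norm_eq_one hu] at h2
        rw [h2, Complex.one_re]
      · rw [opTrace_mul_rankOne, hAu, inner_smul_right, inner_self_eq_one_of_norm_eq_one hu,
          mul_one, Complex.ofReal_re]
  · obtain ⟨B, hB, htr, h⟩ := exists_re_opTrace_mul_rpow_eq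
      (one_le_of_inv_add_inv_eq_one hp') hpt' hA
    exact ⟨_, CFC.rpow_nonneg, schattenNorm_rpow_le_one hp' hpt' hB htr, h⟩

lemma schattenNorm_mul_comm {p : ℝ≥0∞} (hpt : p ≠ ∞) {S T : H →L[ℂ] H} (h : 0 ≤ S * T)
    (h' : 0 ≤ T * S) : schattenNorm p (S * T) = schattenNorm p (T * S) := by
  rw [schattenNorm_of_nonneg hpt h, schattenNorm_of_nonneg hpt h', opTrace_rpow_mul_comm h h']

end Duality

/-! ### Lieb's concavity theorem -/

section Lieb

open MeasureTheory Set

/-- The parallel sum of two nonnegative numbers bounds the cost of splitting `k`. Where `a = b = 0`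
the quotient is zero, which is the correct value. -/
lemma harmonic_mul_norm_sq_le {a b : ℝ} (ha : 0 ≤ a) (hb : 0 ≤ b) (k x : ℂ) :
    a * b / (a + b) * ‖k‖ ^ 2 ≤ a * ‖x‖ ^ 2 + b * ‖k - x‖ ^ 2 := by
  rcases (add_nonneg ha hb).eq_or_lt with h | h
  · rw [← h, div_zero, zero_mul]
    positivity
  · have h1 : ‖k‖ ≤ ‖x‖ + ‖k - x‖ := by
      simpa using norm_add_le x (k - x)
    have h2 : ‖k‖ ^ 2 ≤ (‖x‖ + ‖k - x‖) ^ 2 := pow_le_pow_left₀ (norm_nonneg _) h1 2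
    rw [div_mul_eq_mul_div, div_le_iff₀ h]
    nlinarith [mul_le_mul_of_nonneg_left h2 (mul_nonneg ha hb), sq_nonneg (a * ‖x‖ - b * ‖k - x‖)]

/-- The optimal splitting in `harmonic_mul_norm_sq_le`. -/
lemma harmonic_mul_norm_sq_eq {a b : ℝ} (ha : 0 ≤ a) (hb : 0 ≤ b) (k : ℂ) :
    a * b / (a + b) * ‖k‖ ^ 2
      = a * ‖((b / (a + b) : ℝ) : ℂ) * k‖ ^ 2 + b * ‖k - ((b / (a + b) : ℝ) : ℂ) * k‖ ^ 2 := by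
  rcases (add_nonneg ha hb).eq_or_lt with h | h
  · have ha0 : a = 0 := by linarith
    have hb0 : b = 0 := by linarith
    simp [ha0, hb0]
  · have h1 : k - ((b / (a + b) : ℝ) : ℂ) * k = ((a / (a + b) : ℝ) : ℂ) * k := by
      have h2 : a / (a + b) = 1 - b / (a + b) := by field_simp; ring
      rw [h2]; push_cast; ring
    rw [h1, norm_mul, norm_mul, Complex.norm_real, Complex.norm_real, mul_pow, mul_pow,
      Real.norm_eq_abs, Real.norm_eq_abs, sq_abs, sq_abs]
    field_simp
    ring

/-- The perspective of the integrand representing `x ^ α` is a parallel sum of `a` and `t b`. -/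
lemma mul_rpowIntegrand₀₁_div {α t a b : ℝ} (ht : 0 < t) (ha : 0 ≤ a) (hb : 0 ≤ b) :
    b * Real.rpowIntegrand₀₁ α t (a / b)
      = t ^ (α - 2) * (a * (t * b) / (a + t * b)) := by
  rcases hb.eq_or_lt with rfl | hb
  · simp
  · have h1 : t ^ (α - 2) = t ^ α / t ^ 2 := by
      rw [Real.rpow_sub ht]; norm_cast
    have h2 : 0 < a + t * b := by positivity
    have h3 : t + a / b = (a + t * b) / b := by field_simp; ring
    rw [Real.rpowIntegrand₀₁, h1, h3]
    field_simp
    ring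

variable {H : Type*} [NormedAddCommGroup H] [InnerProductSpace ℂ H] [CompleteSpace H]

/-- The functional `tr (X⋆ A X) + t tr ((K - X) B (K - X)⋆)`. Its minimum over `X` is, in the
Hilbert–Schmidt space, the value at `K` of the quadratic form of the parallel sum of left
multiplication by `A` and right multiplication by `t B`. -/
noncomputable def splitCost (t : ℝ) (K A B X : H →L[ℂ] H) : ℝ :=
  (opTrace (star X * A * X)).re + t * (opTrace ((K - X) * B * star (K - X))).re

lemma splitCost_convexCombination (t : ℝ) (K A₁ A₂ B₁ B₂ X : H →L[ℂ] H) (r s : ℝ) :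
    splitCost t K (r • A₁ + s • A₂) (r • B₁ + s • B₂) X
      = r * splitCost t K A₁ B₁ X + s * splitCost t K A₂ B₂ X := by
  simp only [splitCost, mul_add, add_mul, opTrace_add, Complex.add_re, mul_smul_comm,
    smul_mul_assoc, ← Complex.coe_smul, opTrace_smul, Complex.re_ofReal_mul]
  ring

lemma inner_apply_eq_of_eigenbasis {ι : Type*} [Fintype ι] {A : H →L[ℂ] H} (hA : 0 ≤ A)
    {e : OrthonormalBasis ι ℂ H} {a : ι → ℝ} (hae : ∀ i, A (e i) = (a i : ℂ) • e i) (i : ι)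
    (v : H) : inner ℂ (e i) (A v) = (a i : ℂ) * inner ℂ (e i) v := by
  have h : inner ℂ (A (e i)) v = inner ℂ (e i) (A v) := by
    nth_rewrite 1 [← (IsSelfAdjoint.of_nonneg hA).star_eq]
    rw [ContinuousLinearMap.star_eq_adjoint, ContinuousLinearMap.adjoint_inner_left]
  rw [← h, hae, inner_smul_left, Complex.conj_ofReal]

/-- Expansion of `tr (X⋆ A X B)` in eigenbases of `A` and `B`. -/
lemma re_opTrace_star_mul_mul_mul {ι κ : Type*} [Fintype ι] [Fintype κ] {A B : H →L[ℂ] H}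
    (hA : 0 ≤ A) {e : OrthonormalBasis ι ℂ H} {a : ι → ℝ}
    (hae : ∀ i, A (e i) = (a i : ℂ) • e i) {f : OrthonormalBasis κ ℂ H} {b : κ → ℝ}
    (hbf : ∀ j, B (f j) = (b j : ℂ) • f j) (X : H →L[ℂ] H) :
    (opTrace (star X * A * X * B)).re
      = ∑ j, ∑ i, a i * b j * ‖inner ℂ (e i) (X (f j))‖ ^ 2 := by
  rw [opTrace_eq_sum f, Complex.re_sum]
  refine Finset.sum_congr rfl fun j _ => ?_
  have h1 : inner ℂ (f j) ((star X * A * X * B) (f j))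
      = (b j : ℂ) * inner ℂ (X (f j)) (A (X (f j))) := by
    rw [mul_apply_eq_comp, mul_apply_eq_comp, mul_apply_eq_comp, hbf, map_smul, map_smul, map_smul,
      inner_smul_right, ContinuousLinearMap.star_eq_adjoint,
      ContinuousLinearMap.adjoint_inner_right]
  rw [h1, ← e.sum_inner_mul_inner, Complex.re_ofReal_mul, Complex.re_sum, Finset.mul_sum]
  refine Finset.sum_congr rfl fun i _ => ?_
  have h2 : inner ℂ (X (f j)) (e i) * inner ℂ (e i) (A (X (f j)))
      = ((a i * ‖inner ℂ (e i) (X (f j))‖ ^ 2 : ℝ) : ℂ) := by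
    rw [inner_apply_eq_of_eigenbasis hA hae, ← inner_conj_symm (X (f j)) (e i)]
    rw [mul_left_comm, ← Complex.normSq_eq_conj_mul_self, Complex.normSq_eq_norm_sq]
    push_cast; rfl
  rw [h2, Complex.ofReal_re]
  ring

lemma splitCost_eq_sum {ι κ : Type*} [Fintype ι] [Fintype κ] {A B : H →L[ℂ] H}
    (hA : 0 ≤ A) {e : OrthonormalBasis ι ℂ H} {a : ι → ℝ}
    (hae : ∀ i, A (e i) = (a i : ℂ) • e i) {f : OrthonormalBasis κ ℂ H} {b : κ → ℝ}
    (hbf : ∀ j, B (f j) = (b j : ℂ) • f j) (t : ℝ) (K X : H →L[ℂ] H) :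
    splitCost t K A B X = ∑ j, ∑ i, (a i * ‖inner ℂ (e i) (X (f j))‖ ^ 2
      + t * b j * ‖inner ℂ (e i) (K (f j)) - inner ℂ (e i) (X (f j))‖ ^ 2) := by
  have h1 := re_opTrace_star_mul_mul_mul hA hae (B := 1) (f := f) (b := fun _ => 1)
    (fun j => by simp) X
  have h2 := re_opTrace_star_mul_mul_mul (A := 1) zero_le_one (e := e) (a := fun _ => 1)
    (fun j => by simp) hbf (K - X)
  rw [mul_one] at h1 h2
  rw [splitCost, h1, opTrace_mul_comm, ← mul_assoc, h2, Finset.mul_sum, ← Finset.sum_add_distrib]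
  refine Finset.sum_congr rfl fun j _ => ?_
  rw [Finset.mul_sum, ← Finset.sum_add_distrib]
  refine Finset.sum_congr rfl fun i _ => ?_
  rw [sub_apply, inner_sub_right]
  ring

lemma rpow_convexCombination_le {β : ℝ} (hβ : β ∈ Icc (0 : ℝ) 1) {B₁ B₂ : H →L[ℂ] H}
    (hB₁ : 0 ≤ B₁) (hB₂ : 0 ≤ B₂) {r s : ℝ} (hr : 0 ≤ r) (hs : 0 ≤ s) (hrs : r + s = 1) :
    r • B₁ ^ β + s • B₂ ^ β ≤ (r • B₁ + s • B₂) ^ β :=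
  (CFC.concaveOn_rpow hβ).2 hB₁ hB₂ hr hs hrs

lemma re_opTrace_mul_mono {A B C : H →L[ℂ] H} (hA : 0 ≤ A) (h : B ≤ C) :
    (opTrace (A * B)).re ≤ (opTrace (A * C)).re := by
  have h1 := re_opTrace_mul_nonneg hA (sub_nonneg.2 h)
  have h2 : A * C = A * B + A * (C - B) := by rw [← mul_add, add_sub_cancel]
  rw [h2, opTrace_add, Complex.add_re]
  linarith

variable [FiniteDimensional ℂ H]

/-- The minimum of `splitCost`, in eigenbases of `A` and `B`: each matrix entry of `K` is split
independently, at the cost of a scalar parallel sum. -/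
lemma isLeast_splitCost {ι κ : Type*} [Fintype ι] [Fintype κ] {A B : H →L[ℂ] H}
    (hA : 0 ≤ A) {e : OrthonormalBasis ι ℂ H} {a : ι → ℝ} (ha : ∀ i, 0 ≤ a i)
    (hae : ∀ i, A (e i) = (a i : ℂ) • e i) {f : OrthonormalBasis κ ℂ H} {b : κ → ℝ}
    (hb : ∀ j, 0 ≤ b j) (hbf : ∀ j, B (f j) = (b j : ℂ) • f j) {t : ℝ} (ht : 0 ≤ t)
    (K : H →L[ℂ] H) :
    IsLeast (range (splitCost t K A B))
      (∑ j, ∑ i, a i * (t * b j) / (a i + t * b j) * ‖inner ℂ (e i) (K (f j))‖ ^ 2) := by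
  constructor
  · -- The minimizer solves `A X = t (K - X) B`, which is diagonal in the two eigenbases.
    let X : H →L[ℂ] H := LinearMap.toContinuousLinearMap (f.toBasis.constr ℂ fun j =>
      ∑ i, (((t * b j / (a i + t * b j) : ℝ) : ℂ) * inner ℂ (e i) (K (f j))) • e i)
    have hX : ∀ i j, inner ℂ (e i) (X (f j))
        = ((t * b j / (a i + t * b j) : ℝ) : ℂ) * inner ℂ (e i) (K (f j)) := by
      intro i j
      have h1 : X (f j) = ∑ i,
          (((t * b j / (a i + t * b j) : ℝ) : ℂ) * inner ℂ (e i) (K (f j))) • e i := by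
        have := f.toBasis.constr_basis ℂ (fun j => ∑ i,
          (((t * b j / (a i + t * b j) : ℝ) : ℂ) * inner ℂ (e i) (K (f j))) • e i) j
        rwa [OrthonormalBasis.coe_toBasis] at this
      rw [h1, e.orthonormal.inner_right_fintype]
    refine ⟨X, ?_⟩
    rw [splitCost_eq_sum hA hae hbf]
    refine Finset.sum_congr rfl fun j _ => Finset.sum_congr rfl fun i _ => ?_
    rw [hX, harmonic_mul_norm_sq_eq (ha i) (mul_nonneg ht (hb j))]
  · rintro _ ⟨X, rfl⟩
    rw [splitCost_eq_sum hA hae hbf]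
    exact Finset.sum_le_sum fun j _ => Finset.sum_le_sum fun i _ =>
      harmonic_mul_norm_sq_le (ha i) (mul_nonneg ht (hb j)) _ _

lemma rpow_mul_rpow_one_sub {α a b : ℝ} (hα : α < 1) (ha : 0 ≤ a) (hb : 0 ≤ b) :
    a ^ α * b ^ (1 - α) = b * (a / b) ^ α := by
  rcases hb.eq_or_lt with rfl | hb
  · rw [Real.zero_rpow (by linarith)]; simp
  · rw [Real.div_rpow ha hb.le, Real.rpow_sub hb, Real.rpow_one]
    ring

/-- Integral representation of `tr (K⋆ A ^ α K B ^ (1 - α))`: the integrand is, up to a positive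
factor, a minimum of functionals that are linear in `(A, B)`. -/
lemma exists_integral_re_opTrace_rpow {α : ℝ} (hα : α ∈ Ioo (0 : ℝ) 1) (K : H →L[ℂ] H) :
    ∃ μ : Measure ℝ, ∀ A B : H →L[ℂ] H, 0 ≤ A → 0 ≤ B → ∃ F : ℝ → ℝ,
      IntegrableOn (fun t => t ^ (α - 2) * F t) (Ioi 0) μ ∧
      (opTrace (star K * A ^ α * K * B ^ (1 - α))).re = ∫ t in Ioi 0, t ^ (α - 2) * F t ∂μ ∧
      ∀ t, 0 < t → IsLeast (range (splitCost t K A B)) (F t) := by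
  obtain ⟨μ, hμ⟩ := Real.exists_measure_rpow_eq_integral_rpowIntegrand₀₁ hα
  refine ⟨μ, fun A B hA hB => ?_⟩
  obtain ⟨e, a, ha, hae⟩ := exists_eigenbasis hA
  obtain ⟨f, b, hb, hbf⟩ := exists_eigenbasis hB
  have hae' : ∀ i, A (e i) = (a i : ℂ) • e i := fun i => by
    simpa [CFC.rpow_one A hA] using hae 1 i
  have hbf' : ∀ j, B (f j) = (b j : ℂ) • f j := fun j => by
    simpa [CFC.rpow_one B hB] using hbf 1 j
  let G : ℝ → ℝ := fun t => ∑ j, ∑ i,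
    (b j * Real.rpowIntegrand₀₁ α t (a i / b j)) * ‖inner ℂ (e i) (K (f j))‖ ^ 2
  have hint : ∀ i j, IntegrableOn (fun t =>
      (b j * Real.rpowIntegrand₀₁ α t (a i / b j)) * ‖inner ℂ (e i) (K (f j))‖ ^ 2) (Ioi 0) μ :=
    fun i j => ((hμ _ (div_nonneg (ha i) (hb j))).1.const_mul _).mul_const _
  have hG : IntegrableOn G (Ioi 0) μ :=
    integrable_finsetSum _ fun j _ => integrable_finsetSum _ fun i _ => hint i j
  have hGF : EqOn G (fun t => t ^ (α - 2) * ∑ j, ∑ i,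
      a i * (t * b j) / (a i + t * b j) * ‖inner ℂ (e i) (K (f j))‖ ^ 2) (Ioi 0) := by
    intro t ht
    simp only [G, Finset.mul_sum]
    refine Finset.sum_congr rfl fun j _ => Finset.sum_congr rfl fun i _ => ?_
    rw [mul_rpowIntegrand₀₁_div ht (ha i) (hb j), mul_assoc]
  refine ⟨_, hG.congr_fun hGF measurableSet_Ioi, ?_, fun t ht =>
    isLeast_splitCost hA ha hae' hb hbf' ht.le K⟩
  rw [← setIntegral_congr_fun measurableSet_Ioi hGF,
    re_opTrace_star_mul_mul_mul CFC.rpow_nonneg (hae α) (hbf (1 - α)) K]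
  simp only [G]
  rw [integral_finsetSum _ fun j _ => integrable_finsetSum _ fun i _ => hint i j]
  refine Finset.sum_congr rfl fun j _ => ?_
  rw [integral_finsetSum _ fun i _ => hint i j]
  refine Finset.sum_congr rfl fun i _ => ?_
  rw [integral_mul_const, integral_const_mul, ← (hμ _ (div_nonneg (ha i) (hb j))).2,
    rpow_mul_rpow_one_sub hα.2 (ha i) (hb j)]

/-- Lieb's concavity theorem for exponents that add up to one. -/
lemma lieb_concavity_one_sub {α : ℝ} (hα : α ∈ Ioo (0 : ℝ) 1) (K : H →L[ℂ] H)
    {A₁ A₂ B₁ B₂ : H →L[ℂ] H} (hA₁ : 0 ≤ A₁) (hA₂ : 0 ≤ A₂) (hB₁ : 0 ≤ B₁) (hB₂ : 0 ≤ B₂)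
    {r s : ℝ} (hr : 0 ≤ r) (hs : 0 ≤ s) :
    r * (opTrace (star K * A₁ ^ α * K * B₁ ^ (1 - α))).re
        + s * (opTrace (star K * A₂ ^ α * K * B₂ ^ (1 - α))).re
      ≤ (opTrace (star K * (r • A₁ + s • A₂) ^ α * K * (r • B₁ + s • B₂) ^ (1 - α))).re := by
  obtain ⟨μ, hμ⟩ := exists_integral_re_opTrace_rpow hα K
  obtain ⟨F₁, hi₁, h₁, hF₁⟩ := hμ A₁ B₁ hA₁ hB₁
  obtain ⟨F₂, hi₂, h₂, hF₂⟩ := hμ A₂ B₂ hA₂ hB₂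
  obtain ⟨F, hi, h, hF⟩ := hμ (r • A₁ + s • A₂) (r • B₁ + s • B₂)
    (add_nonneg (smul_nonneg hr hA₁) (smul_nonneg hs hA₂))
    (add_nonneg (smul_nonneg hr hB₁) (smul_nonneg hs hB₂))
  rw [h₁, h₂, h, ← integral_const_mul, ← integral_const_mul,
    ← integral_add (hi₁.const_mul r) (hi₂.const_mul s)]
  refine setIntegral_mono_on ((hi₁.const_mul r).add (hi₂.const_mul s)) hi measurableSet_Ioi
    fun t ht => ?_
  have ht : 0 < t := ht
  obtain ⟨X, hX⟩ := (hF t ht).1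
  have hle₁ := (hF₁ t ht).2 (mem_range_self X)
  have hle₂ := (hF₂ t ht).2 (mem_range_self X)
  have hle : r * F₁ t + s * F₂ t ≤ F t := by
    rw [← hX, splitCost_convexCombination]
    gcongr
  calc r * (t ^ (α - 2) * F₁ t) + s * (t ^ (α - 2) * F₂ t)
      = t ^ (α - 2) * (r * F₁ t + s * F₂ t) := by ring
    _ ≤ t ^ (α - 2) * F t := by gcongr

/-- Lieb's concavity theorem: `(A, B) ↦ tr (K⋆ A ^ α K B ^ β)` is jointly concave on positive
operators for `0 ≤ α, β` and `α + β ≤ 1`. -/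
theorem lieb_concavity {α β : ℝ} (hα : 0 ≤ α) (hβ : 0 ≤ β) (hαβ : α + β ≤ 1) (K : H →L[ℂ] H)
    {A₁ A₂ B₁ B₂ : H →L[ℂ] H} (hA₁ : 0 ≤ A₁) (hA₂ : 0 ≤ A₂) (hB₁ : 0 ≤ B₁) (hB₂ : 0 ≤ B₂)
    {r s : ℝ} (hr : 0 ≤ r) (hs : 0 ≤ s) (hrs : r + s = 1) :
    r * (opTrace (star K * A₁ ^ α * K * B₁ ^ β)).re
        + s * (opTrace (star K * A₂ ^ α * K * B₂ ^ β)).re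
      ≤ (opTrace (star K * (r • A₁ + s • A₂) ^ α * K * (r • B₁ + s • B₂) ^ β)).re := by
  have hA : 0 ≤ r • A₁ + s • A₂ := add_nonneg (smul_nonneg hr hA₁) (smul_nonneg hs hA₂)
  have hB : 0 ≤ r • B₁ + s • B₂ := add_nonneg (smul_nonneg hr hB₁) (smul_nonneg hs hB₂)
  have hpos : ∀ {D : H →L[ℂ] H}, 0 ≤ D → 0 ≤ star K * D * K := fun h =>
    star_left_conjugate_nonneg h K
  have hlin : ∀ M N₁ N₂ : H →L[ℂ] H, r * (opTrace (M * N₁)).re + s * (opTrace (M * N₂)).re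
      = (opTrace (M * (r • N₁ + s • N₂))).re := by
    intro M N₁ N₂
    simp only [mul_add, opTrace_add, Complex.add_re, mul_smul_comm, ← Complex.coe_smul,
      opTrace_smul, Complex.re_ofReal_mul]
  rcases hα.eq_or_lt with rfl | hα
  · rw [CFC.rpow_zero A₁ hA₁, CFC.rpow_zero A₂ hA₂, CFC.rpow_zero _ hA, hlin]
    exact re_opTrace_mul_mono (hpos zero_le_one)
      (rpow_convexCombination_le ⟨hβ, by linarith⟩ hB₁ hB₂ hr hs hrs)
  rcases hβ.eq_or_lt with rfl | hβ
  · rw [CFC.rpow_zero B₁ hB₁, CFC.rpow_zero B₂ hB₂, CFC.rpow_zero _ hB]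
    simp only [mul_one]
    have hcyc : ∀ D : H →L[ℂ] H, opTrace (star K * D * K) = opTrace (K * star K * D) := by
      intro D
      rw [opTrace_mul_comm, ← mul_assoc]
    rw [hcyc, hcyc, hcyc, hlin]
    exact re_opTrace_mul_mono (mul_star_self_nonneg K)
      (rpow_convexCombination_le ⟨hα.le, by linarith⟩ hA₁ hA₂ hr hs hrs)
  -- Write `B ^ β = (B ^ θ) ^ (1 - α)` with `θ = β / (1 - α) ≤ 1` and use operator concavity of
  -- `B ↦ B ^ θ`.
  have hα1 : 0 < 1 - α := by linarith
  have hθ0 : 0 ≤ β / (1 - α) := by positivity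
  have hθ1 : β / (1 - α) ≤ 1 := (div_le_one hα1).2 (by linarith)
  have hpow : ∀ {B : H →L[ℂ] H}, 0 ≤ B → B ^ β = (B ^ (β / (1 - α))) ^ (1 - α) := by
    intro B hB
    rw [CFC.rpow_rpow_of_exponent_nonneg B _ _ hθ0 hα1.le hB, div_mul_cancel₀ _ hα1.ne']
  rw [hpow hB₁, hpow hB₂, hpow hB]
  refine (lieb_concavity_one_sub ⟨hα, by linarith⟩ K hA₁ hA₂ CFC.rpow_nonneg CFC.rpow_nonneg hr
    hs).trans ?_
  exact re_opTrace_mul_mono (hpos CFC.rpow_nonneg) (CFC.rpow_le_rpow ⟨hα1.le, by linarith⟩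
    (rpow_convexCombination_le ⟨hθ0, hθ1⟩ hB₁ hB₂ hr hs hrs))

end Lieb

/-! ### Concavity of `c ↦ ‖c ^ (α / 2) Z c ^ (α / 2)‖_p` -/

section Concavity

variable {H : Type*} [NormedAddCommGroup H] [InnerProductSpace ℂ H] [CompleteSpace H]

lemma rpow_conj_nonneg (c : H →L[ℂ] H) (a : ℝ) {Z : H →L[ℂ] H} (hZ : 0 ≤ Z) :
    0 ≤ c ^ a * Z * c ^ a :=
  (IsSelfAdjoint.of_nonneg CFC.rpow_nonneg).conjugate_nonneg hZ

lemma opTrace_rpow_conj_mul {c : H →L[ℂ] H} (hc : IsStrictlyPositive c) (a : ℝ)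
    (X Z : H →L[ℂ] H) :
    opTrace ((c ^ (-a) * X * c ^ (-a)) * (c ^ a * Z * c ^ a)) = opTrace (X * Z) := by
  have h1 : (c ^ (-a) * X * c ^ (-a)) * (c ^ a * Z * c ^ a)
      = c ^ (-a) * (X * (c ^ (-a) * c ^ a) * Z * c ^ a) := by simp only [mul_assoc]
  rw [h1, CFC.rpow_neg_mul_rpow a hc, mul_one, opTrace_mul_comm, mul_assoc (X * Z),
    CFC.rpow_mul_rpow_neg a hc, mul_one]

lemma rpow_conj_rpow_neg_conj {c : H →L[ℂ] H} (hc : IsStrictlyPositive c) (a : ℝ)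
    (X : H →L[ℂ] H) : c ^ a * (c ^ (-a) * X * c ^ (-a)) * c ^ a = X := by
  have h1 : c ^ a * (c ^ (-a) * X * c ^ (-a)) * c ^ a
      = (c ^ a * c ^ (-a)) * X * (c ^ (-a) * c ^ a) := by simp only [mul_assoc]
  rw [h1, CFC.rpow_neg_mul_rpow a hc, CFC.rpow_mul_rpow_neg a hc, mul_one, one_mul]

variable [FiniteDimensional ℂ H]

lemma schattenNorm_rpow_conj {p : ℝ≥0∞} (hpt : p ≠ ∞) {c Z : H →L[ℂ] H} (hZ : 0 ≤ Z)
    {a : ℝ} (ha : 0 ≤ a) : schattenNorm p (c ^ (a / 2) * Z * c ^ (a / 2))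
      = schattenNorm p (Z ^ (1 / 2 : ℝ) * c ^ a * Z ^ (1 / 2 : ℝ)) := by
  have hZ2 : Z = Z ^ (1 / 2 : ℝ) * Z ^ (1 / 2 : ℝ) := by
    rw [← CFC.sqrt_eq_rpow, CFC.sqrt_mul_sqrt_self Z hZ]
  have hc2 : c ^ a = c ^ (a / 2) * c ^ (a / 2) := by
    rw [← rpow_add_of_nonneg c (by positivity) (by positivity), add_halves]
  have h1 : c ^ (a / 2) * Z * c ^ (a / 2)
      = (c ^ (a / 2) * Z ^ (1 / 2 : ℝ)) * (Z ^ (1 / 2 : ℝ) * c ^ (a / 2)) := by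
    conv_lhs => rw [hZ2]
    simp only [mul_assoc]
  have h2 : Z ^ (1 / 2 : ℝ) * c ^ a * Z ^ (1 / 2 : ℝ)
      = (Z ^ (1 / 2 : ℝ) * c ^ (a / 2)) * (c ^ (a / 2) * Z ^ (1 / 2 : ℝ)) := by
    rw [hc2]
    simp only [mul_assoc]
  have h3 := rpow_conj_nonneg c (a / 2) hZ
  have h4 := rpow_conj_nonneg Z (1 / 2) (CFC.rpow_nonneg : 0 ≤ c ^ a)
  rw [h1] at h3
  rw [h2] at h4
  rw [h1, h2, schattenNorm_mul_comm hpt h3 h4]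

/-- Epstein-type concavity: `c ↦ ‖c ^ (α / 2) Z c ^ (α / 2)‖_p` is concave on positive operators
for `0 ≤ α ≤ 1 / p`. It follows from Lieb's theorem, as a partial supremum over density operators
`B` of the jointly concave functions `tr (Z ^ (1 / 2) c ^ α Z ^ (1 / 2) B ^ (1 - 1 / p))`. -/
theorem schattenNorm_rpow_conj_concave {p p' : ℝ≥0∞} (hp : p⁻¹ + p'⁻¹ = 1) {α : ℝ} (hα : 0 ≤ α)
    (hαp : α ≤ (p⁻¹).toReal) {Z : H →L[ℂ] H} (hZ : 0 ≤ Z) {c₁ c₂ : H →L[ℂ] H} (hc₁ : 0 ≤ c₁)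
    (hc₂ : 0 ≤ c₂) {r s : ℝ} (hr : 0 ≤ r) (hs : 0 ≤ s) (hrs : r + s = 1) :
    r * schattenNorm p (c₁ ^ (α / 2) * Z * c₁ ^ (α / 2))
        + s * schattenNorm p (c₂ ^ (α / 2) * Z * c₂ ^ (α / 2))
      ≤ schattenNorm p ((r • c₁ + s • c₂) ^ (α / 2) * Z * (r • c₁ + s • c₂) ^ (α / 2)) := by
  have hc : 0 ≤ r • c₁ + s • c₂ := add_nonneg (smul_nonneg hr hc₁) (smul_nonneg hs hc₂)
  by_cases hpt : p = ∞
  · have h0 : α = 0 := le_antisymm (by simpa [hpt] using hαp) hα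
    rw [h0, zero_div, CFC.rpow_zero c₁ hc₁, CFC.rpow_zero c₂ hc₂, CFC.rpow_zero _ hc, ← add_mul,
      hrs, one_mul]
  rw [schattenNorm_rpow_conj hpt hZ hα, schattenNorm_rpow_conj hpt hZ hα,
    schattenNorm_rpow_conj hpt hZ hα]
  have hp1 := one_le_of_inv_add_inv_eq_one hp
  have hK : star (Z ^ (1 / 2 : ℝ)) = Z ^ (1 / 2 : ℝ) :=
    (IsSelfAdjoint.of_nonneg CFC.rpow_nonneg).star_eq
  have hM : ∀ c : H →L[ℂ] H, 0 ≤ Z ^ (1 / 2 : ℝ) * c ^ α * Z ^ (1 / 2 : ℝ) := fun c =>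
    rpow_conj_nonneg Z (1 / 2) CFC.rpow_nonneg
  obtain ⟨B₁, hB₁, ht₁, h₁⟩ := exists_re_opTrace_mul_rpow_eq hp1 hpt (hM c₁)
  obtain ⟨B₂, hB₂, ht₂, h₂⟩ := exists_re_opTrace_mul_rpow_eq hp1 hpt (hM c₂)
  have hB : 0 ≤ r • B₁ + s • B₂ := add_nonneg (smul_nonneg hr hB₁) (smul_nonneg hs hB₂)
  have htr : (opTrace (r • B₁ + s • B₂)).re ≤ 1 := by
    rw [opTrace_add, ← Complex.coe_smul, ← Complex.coe_smul, opTrace_smul, opTrace_smul,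
      Complex.add_re, Complex.re_ofReal_mul, Complex.re_ofReal_mul]
    nlinarith
  refine le_trans ?_ (re_opTrace_mul_rpow_le hp hpt (hM _) hB htr)
  rw [← h₁, ← h₂]
  have hpinv : (p⁻¹).toReal = 1 / p.toReal := by rw [ENNReal.toReal_inv, one_div]
  have hp1' : 1 / p.toReal ≤ 1 := by
    rw [← hpinv]
    exact ENNReal.toReal_mono ENNReal.one_ne_top (ENNReal.inv_le_one.2 hp1)
  have := lieb_concavity hα (sub_nonneg.2 hp1') (by rw [← hpinv]; linarith) (Z ^ (1 / 2 : ℝ))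
    hc₁ hc₂ hB₁ hB₂ hr hs hrs
  rwa [hK] at this

end Concavity

/-! ### Separation and the dual witness -/

section HahnBanach

variable {H : Type*} [NormedAddCommGroup H] [InnerProductSpace ℂ H]
  [FiniteDimensional ℂ H]

/-- The bipolar theorem for the cone of positive operators. No self-adjointness is assumed: the test
operators include all skew-adjoint ones, which forces `Y` to be self-adjoint. -/
lemma nonneg_of_re_opTrace_mul_le_one {Y : H →L[ℂ] H}
    (h : ∀ X : H →L[ℂ] H, (∀ Z, 0 ≤ Z → (opTrace (X * Z)).re ≤ 0) → (opTrace (X * Y)).re ≤ 1) :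
    0 ≤ Y := by
  -- Test on multiples `z • |v⟩⟨v|` with `Re z ≤ 0`, which contains a line and a half-line.
  have key : ∀ (z : ℂ) (v : H), z.re ≤ 0 → (z * inner ℂ v (Y v)).re ≤ 1 := by
    intro z v hz
    have hrank : ∀ Z : H →L[ℂ] H, opTrace ((z • InnerProductSpace.rankOne ℂ v v) * Z)
        = z * inner ℂ v (Z v) := by
      intro Z
      rw [smul_mul_assoc, opTrace_smul, opTrace_mul_comm, opTrace_mul_rankOne]
    have := h (z • InnerProductSpace.rankOne ℂ v v) fun Z hZ => by
      have h1 := ((ContinuousLinearMap.nonneg_iff_isPositive _).1 hZ).inner_nonneg_right v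
      obtain ⟨h2, h3⟩ := Complex.le_def.1 h1
      rw [hrank, Complex.mul_re, ← h3]
      simp only [Complex.zero_im, mul_zero, sub_zero]
      exact mul_nonpos_of_nonpos_of_nonneg hz h2
    rwa [hrank] at this
  have him : ∀ v, (inner ℂ v (Y v)).im = 0 := by
    intro v
    by_contra hne
    have h1 := key (((-2 / (inner ℂ v (Y v)).im : ℝ) : ℂ) * Complex.I) v (by simp)
    rw [mul_assoc, Complex.re_ofReal_mul, Complex.I_mul_re, mul_neg, div_mul_cancel₀ _ hne] at h1
    norm_num at h1
  have hre : ∀ v, 0 ≤ (inner ℂ v (Y v)).re := by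
    intro v
    by_contra! hlt
    have h1 := key ((2 / (inner ℂ v (Y v)).re : ℝ) : ℂ) v (by
      rw [Complex.ofReal_re]; exact div_nonpos_of_nonneg_of_nonpos zero_le_two hlt.le)
    rw [Complex.re_ofReal_mul, div_mul_cancel₀ _ hlt.ne] at h1
    norm_num at h1
  rw [ContinuousLinearMap.nonneg_iff_isPositive, ContinuousLinearMap.isPositive_iff_complex]
  intro v
  have h1 : inner ℂ (Y v) v = (starRingEnd ℂ) (inner ℂ v (Y v)) := (inner_conj_symm _ _).symm
  have h2 : (inner ℂ (Y v) v).im = 0 := by rw [h1, Complex.conj_im, him, neg_zero]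
  have h3 : 0 ≤ (inner ℂ (Y v) v).re := by rw [h1, Complex.conj_re]; exact hre v
  exact ⟨Complex.ext rfl h2.symm, h3⟩

variable [CompleteSpace H]

/-- The trace pairing is nondegenerate, because `tr (Y⋆ Y)` is the squared Hilbert–Schmidt norm, so
in finite dimension it represents every real linear functional. -/
lemma exists_eq_re_opTrace_mul (f : (H →L[ℂ] H) →ₗ[ℝ] ℝ) :
    ∃ Y : H →L[ℂ] H, ∀ X, f X = (opTrace (X * Y)).re := by
  have : FiniteDimensional ℝ (H →L[ℂ] H) := FiniteDimensional.complexToReal _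
  let T : (H →L[ℂ] H) →ₗ[ℝ] Module.Dual ℝ (H →L[ℂ] H) :=
    LinearMap.mk₂ ℝ (fun Y X => (opTrace (X * Y)).re)
      (fun Y Y' X => by rw [mul_add, opTrace_add, Complex.add_re])
      (fun r Y X => by
        rw [mul_smul_comm, ← Complex.coe_smul, opTrace_smul, Complex.re_ofReal_mul, smul_eq_mul])
      (fun Y X X' => by rw [add_mul, opTrace_add, Complex.add_re])
      (fun r Y X => by
        rw [smul_mul_assoc, ← Complex.coe_smul, opTrace_smul, Complex.re_ofReal_mul, smul_eq_mul])
  have hT : Function.Injective T := by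
    refine (injective_iff_map_eq_zero T).2 fun Y hY => ?_
    have h1 : (opTrace (star Y * Y)).re = 0 := LinearMap.congr_fun hY (star Y)
    have h2 := re_opTrace_star_mul_mul_mul (A := 1) (B := 1) zero_le_one
      (e := stdOrthonormalBasis ℂ H) (a := fun _ => 1) (fun j => by simp)
      (f := stdOrthonormalBasis ℂ H) (b := fun _ => 1) (fun j => by simp) Y
    rw [mul_one, mul_one, h1] at h2
    have h3 : ∀ j, Y (stdOrthonormalBasis ℂ H j) = 0 := by
      intro j
      have h4 := (Finset.sum_eq_zero_iff_of_nonneg fun j _ => Finset.sum_nonneg fun i _ =>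
        by positivity).1 h2.symm j (Finset.mem_univ j)
      have h5 : ‖Y (stdOrthonormalBasis ℂ H j)‖ ^ 2 = 0 := by
        rw [← (stdOrthonormalBasis ℂ H).sum_sq_norm_inner_right, ← h4]
        simp
      simpa using h5
    refine ContinuousLinearMap.coe_injective ((stdOrthonormalBasis ℂ H).toBasis.ext fun j => ?_)
    simpa using h3 j
  obtain ⟨Y, hY⟩ := (LinearMap.injective_iff_surjective_of_finrank_eq_finrank
    Subspace.dual_finrank_eq.symm).1 hT f
  exact ⟨Y, fun X => (LinearMap.congr_fun hY X).symm⟩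

/-- The operators dominated, as functionals on positive operators, by one of the functions
`Z ↦ ‖c ^ (α / 2) Z c ^ (α / 2)‖_p` with `c ∈ C` positive definite. -/
def dominatedSet (C : Set (H →L[ℂ] H)) (p : ℝ≥0∞) (α : ℝ) : Set (H →L[ℂ] H) :=
  {X | ∃ c ∈ C, IsStrictlyPositive c ∧ ∀ Z, 0 ≤ Z →
    (opTrace (X * Z)).re ≤ schattenNorm p (c ^ (α / 2) * Z * c ^ (α / 2))}

lemma convex_dominatedSet {C : Set (H →L[ℂ] H)} (hC : Convex ℝ C) {p p' : ℝ≥0∞}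
    (hp : p⁻¹ + p'⁻¹ = 1) {α : ℝ} (hα : 0 ≤ α) (hαp : α ≤ (p⁻¹).toReal) :
    Convex ℝ (dominatedSet C p α) := by
  rintro X₁ ⟨c₁, hc₁, hpos₁, h₁⟩ X₂ ⟨c₂, hc₂, hpos₂, h₂⟩ r s hr hs hrs
  refine ⟨r • c₁ + s • c₂, hC hc₁ hc₂ hr hs hrs, ?_, fun Z hZ => ?_⟩
  · rcases hr.eq_or_lt with rfl | hr'
    · have : s = 1 := by linarith
      simpa [this] using hpos₂
    · exact (hpos₁.smul hr').add_nonneg (smul_nonneg hs hpos₂.nonneg)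
  · refine le_trans ?_ (schattenNorm_rpow_conj_concave hp hα hαp hZ hpos₁.nonneg hpos₂.nonneg hr hs
      hrs)
    rw [add_mul, opTrace_add, smul_mul_assoc, smul_mul_assoc, ← Complex.coe_smul,
      ← Complex.coe_smul, opTrace_smul, opTrace_smul, Complex.add_re, Complex.re_ofReal_mul,
      Complex.re_ofReal_mul]
    have h1 := h₁ Z hZ
    have h2 := h₂ Z hZ
    gcongr

/-- By Hölder's inequality, with the positive factor `c ^ (α / 2) Z c ^ (α / 2)`, the set
`dominatedSet C p α` contains the unit ball of `X ↦ ‖c ^ (-α / 2) X c ^ (-α / 2)‖_{p'}`, for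
arbitrary operators `X`. -/
lemma mem_dominatedSet {C : Set (H →L[ℂ] H)} {p p' : ℝ≥0∞}
    (hp : p⁻¹ + p'⁻¹ = 1) {α : ℝ} {c : H →L[ℂ] H} (hc : c ∈ C) (hpos : IsStrictlyPositive c)
    {X : H →L[ℂ] H} (hX : schattenNorm p' (c ^ (-(α / 2)) * X * c ^ (-(α / 2))) ≤ 1) :
    X ∈ dominatedSet C p α := by
  refine ⟨c, hc, hpos, fun Z hZ => ?_⟩
  rw [← opTrace_rpow_conj_mul hpos (α / 2), opTrace_mul_comm]
  refine (Complex.re_le_norm _).trans ?_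
  refine (norm_opTrace_mul_le (by rwa [add_comm] : p'⁻¹ + p⁻¹ = 1)
    (rpow_conj_nonneg c (α / 2) hZ) _).trans ?_
  exact mul_le_of_le_one_right (schattenNorm_nonneg _ _) hX

lemma zero_mem_interior_dominatedSet {C : Set (H →L[ℂ] H)} {p p' : ℝ≥0∞}
    (hp : p⁻¹ + p'⁻¹ = 1) {α : ℝ} {c : H →L[ℂ] H} (hc : c ∈ C) (hpos : IsStrictlyPositive c) :
    0 ∈ interior (dominatedSet C p α) := by
  have hp' : 1 ≤ p' := one_le_of_inv_add_inv_eq_one (by rwa [add_comm] : p'⁻¹ + p⁻¹ = 1)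
  have hcont : Continuous fun X : H →L[ℂ] H =>
      schattenNorm p' (c ^ (-(α / 2)) * X * c ^ (-(α / 2))) :=
    (continuous_schattenNorm hp').comp ((continuous_const.mul continuous_id).mul continuous_const)
  have h0 : schattenNorm p' (c ^ (-(α / 2)) * 0 * c ^ (-(α / 2))) = 0 := by
    rw [mul_zero, zero_mul, schattenNorm_zero hp']
  exact mem_interior.2 ⟨_, fun X hX => mem_dominatedSet hp hc hpos (le_of_lt hX),
    isOpen_lt hcont continuous_const, h0.trans_lt one_pos⟩

/-- For positive `X`, the converse of `mem_dominatedSet`, by testing against the dual element of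
`c ^ (-α / 2) X c ^ (-α / 2)`. -/
lemma schattenNorm_le_of_mem_dominatedSet {C : Set (H →L[ℂ] H)} {p p' : ℝ≥0∞}
    (hp : p⁻¹ + p'⁻¹ = 1) {α t : ℝ} (ht : 0 < t) {X : H →L[ℂ] H} (hX : 0 ≤ X)
    (h : t⁻¹ • X ∈ dominatedSet C p α) :
    ∃ c ∈ C, IsStrictlyPositive c ∧
      schattenNorm p' (c ^ (-(α / 2)) * X * c ^ (-(α / 2))) ≤ t := by
  obtain ⟨c, hc, hpos, hdom⟩ := h
  refine ⟨c, hc, hpos, ?_⟩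
  obtain ⟨W, hW, hW1, htr⟩ := exists_re_opTrace_mul_eq_schattenNorm hp
    (rpow_conj_nonneg c (-(α / 2)) hX)
  have h1 := hdom _ (rpow_conj_nonneg c (-(α / 2)) hW)
  rw [rpow_conj_rpow_neg_conj hpos, smul_mul_assoc, ← Complex.coe_smul, opTrace_smul,
    Complex.re_ofReal_mul] at h1
  have h2 : opTrace (X * (c ^ (-(α / 2)) * W * c ^ (-(α / 2))))
      = opTrace ((c ^ (-(α / 2)) * X * c ^ (-(α / 2))) * W) := by
    rw [← opTrace_rpow_conj_mul hpos (α / 2), rpow_conj_rpow_neg_conj hpos]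
  rw [h2, htr] at h1
  have h3 := h1.trans hW1
  rwa [inv_mul_le_iff₀ ht, mul_one] at h3

/-- The dual witness: if `t` lies below `‖c ^ (-α / 2) X c ^ (-α / 2)‖_{p'}` for every positive
definite `c ∈ C`, separating `X / t` from `dominatedSet C p α` yields a positive `Y` that is
feasible for the dual problem and has `tr (X Y) ≥ t`. -/
lemma exists_nonneg_le_re_opTrace_mul {C : Set (H →L[ℂ] H)} (hC : Convex ℝ C)
    (hC_pos : ∃ c ∈ C, IsStrictlyPositive c) {p p' : ℝ≥0∞}
    (hp : p⁻¹ + p'⁻¹ = 1) {α : ℝ} (hα : 0 ≤ α) (hαp : α ≤ (p⁻¹).toReal) {t : ℝ} (ht : 0 < t)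
    {X : H →L[ℂ] H} (hX : 0 ≤ X) (hlt : ∀ c ∈ C, IsStrictlyPositive c →
      t < schattenNorm p' (c ^ (-(α / 2)) * X * c ^ (-(α / 2)))) :
    ∃ Y : H →L[ℂ] H, 0 ≤ Y ∧ (∀ c ∈ C, IsStrictlyPositive c →
      schattenNorm p (c ^ (α / 2) * Y * c ^ (α / 2)) ≤ 1) ∧ t ≤ (opTrace (X * Y)).re := by
  obtain ⟨c₀, hc₀, hpos₀⟩ := hC_pos
  have h0 := zero_mem_interior_dominatedSet (α := α) hp hc₀ hpos₀
  have hnot : t⁻¹ • X ∉ dominatedSet C p α := by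
    intro hmem
    obtain ⟨c, hc, hpos, hle⟩ := schattenNorm_le_of_mem_dominatedSet hp ht hX hmem
    exact (hlt c hc hpos).not_ge hle
  have hconv := convex_dominatedSet hC hp hα hαp
  obtain ⟨f, u, hf, hu⟩ := geometric_hahn_banach_open hconv.interior isOpen_interior
    (convex_singleton (t⁻¹ • X))
    (Set.disjoint_singleton_right.2 fun h => hnot (interior_subset h))
  have hu0 : 0 < u := by simpa using hf 0 h0
  have hfX : u ≤ f (t⁻¹ • X) := hu _ rfl
  have hle : ∀ Z ∈ dominatedSet C p α, f Z ≤ u := by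
    intro Z hZ
    have h1 : Z ∈ closure (interior (dominatedSet C p α)) := by
      rw [hconv.closure_interior_eq_closure_of_nonempty_interior ⟨0, h0⟩]
      exact subset_closure hZ
    exact closure_minimal (fun W hW => (hf W hW).le)
      (isClosed_Iic.preimage f.continuous) h1
  obtain ⟨Y, hY⟩ := exists_eq_re_opTrace_mul (u⁻¹ • (f : (H →L[ℂ] H) →ₗ[ℝ] ℝ))
  have hY' : ∀ Z, (opTrace (Z * Y)).re = u⁻¹ * f Z := fun Z => (hY Z).symm
  have hdom : ∀ Z ∈ dominatedSet C p α, (opTrace (Z * Y)).re ≤ 1 := by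
    intro Z hZ
    rw [hY', inv_mul_le_iff₀ hu0, mul_one]
    exact hle Z hZ
  have hYpos : 0 ≤ Y := nonneg_of_re_opTrace_mul_le_one fun Z hZ =>
    hdom Z ⟨c₀, hc₀, hpos₀, fun W hW => (hZ W hW).trans (schattenNorm_nonneg _ _)⟩
  refine ⟨Y, hYpos, fun c hc hpos => ?_, ?_⟩
  · obtain ⟨W, hW, hW1, htr⟩ := exists_re_opTrace_mul_eq_schattenNorm
      (by rwa [add_comm] : p'⁻¹ + p⁻¹ = 1) (rpow_conj_nonneg c (α / 2) hYpos)
    have h1 := rpow_conj_rpow_neg_conj hpos (-(α / 2)) W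
    rw [neg_neg] at h1
    have h2 := hdom (c ^ (α / 2) * W * c ^ (α / 2))
      (mem_dominatedSet hp hc hpos (by rwa [h1]))
    rwa [← opTrace_rpow_conj_mul hpos (α / 2), h1, opTrace_mul_comm, htr] at h2
  · have h1 : (opTrace (X * Y)).re = t * (u⁻¹ * f (t⁻¹ • X)) := by
      rw [hY', map_smul, smul_eq_mul]
      field_simp
    rw [h1]
    refine le_mul_of_one_le_right ht.le ?_
    rwa [le_inv_mul_iff₀ hu0, mul_one]

end HahnBanach

/-! ### The dual norm formula -/

section DualNorm

variable {H : Type*} [NormedAddCommGroup H] [InnerProductSpace ℂ H] [CompleteSpace H]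

lemma invDiff_eq_invDiff {p q p' q' : ℝ≥0∞} (hp : p⁻¹ + p'⁻¹ = 1) (hq : q⁻¹ + q'⁻¹ = 1) :
    invDiff q' p' = invDiff p q := by
  have h : ∀ {x y : ℝ≥0∞}, x⁻¹ + y⁻¹ = 1 → (x⁻¹).toReal + (y⁻¹).toReal = 1 := by
    intro x y hxy
    have hx : x⁻¹ ≠ ∞ := ne_top_of_le_ne_top ENNReal.one_ne_top (hxy ▸ le_self_add)
    have hy : y⁻¹ ≠ ∞ := ne_top_of_le_ne_top ENNReal.one_ne_top (hxy ▸ le_add_self)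
    rw [← ENNReal.toReal_add hx hy, hxy, ENNReal.toReal_one]
  have h1 := h hp
  have h2 := h hq
  unfold invDiff
  linarith

lemma invDiff_nonneg {a b : ℝ≥0∞} (ha : 1 ≤ a) (hab : a ≤ b) : 0 ≤ invDiff a b :=
  sub_nonneg.2 <| ENNReal.toReal_mono (ENNReal.inv_ne_top.2 (zero_lt_one.trans_le ha).ne')
    (ENNReal.inv_le_inv.2 hab)

variable [FiniteDimensional ℂ H]

/-- It is enough to test the dual constraint on the positive definite elements of `C`, because
`c ↦ ‖c ^ (α / 2) Y c ^ (α / 2)‖_p` is concave and `C` contains a positive definite element. -/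
lemma schattenNorm_rpow_conj_le_one {C : Set (H →L[ℂ] H)} (hC_psd : ∀ c ∈ C, 0 ≤ c)
    (hC : Convex ℝ C) (hC_pos : ∃ c ∈ C, IsStrictlyPositive c) {p p' : ℝ≥0∞}
    (hp : p⁻¹ + p'⁻¹ = 1) {α : ℝ} (hα : 0 ≤ α) (hαp : α ≤ (p⁻¹).toReal) {Y : H →L[ℂ] H}
    (hY : 0 ≤ Y) (h : ∀ c ∈ C, IsStrictlyPositive c →
      schattenNorm p (c ^ (α / 2) * Y * c ^ (α / 2)) ≤ 1) {c : H →L[ℂ] H} (hc : c ∈ C) :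
    schattenNorm p (c ^ (α / 2) * Y * c ^ (α / 2)) ≤ 1 := by
  obtain ⟨c₀, hc₀, hpos₀⟩ := hC_pos
  have key : ∀ ε : ℝ, 0 < ε → ε ≤ 1 →
      (1 - ε) * schattenNorm p (c ^ (α / 2) * Y * c ^ (α / 2)) ≤ 1 := by
    intro ε hε hε1
    have h1 := schattenNorm_rpow_conj_concave hp hα hαp hY (hC_psd c hc) hpos₀.nonneg
      (sub_nonneg.2 hε1) hε.le (sub_add_cancel 1 ε)
    have h2 := h ((1 - ε) • c + ε • c₀)
      (hC hc hc₀ (sub_nonneg.2 hε1) hε.le (sub_add_cancel 1 ε)) (by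
        rw [add_comm]
        exact (hpos₀.smul hε).add_nonneg (smul_nonneg (sub_nonneg.2 hε1) (hC_psd c hc)))
    have h3 := mul_nonneg hε.le
      (schattenNorm_nonneg p (c₀ ^ (α / 2) * Y * c₀ ^ (α / 2)))
    linarith
  refine le_of_forall_pos_lt_add fun δ hδ => ?_
  by_contra! hle
  set x := schattenNorm p (c ^ (α / 2) * Y * c ^ (α / 2))
  have hx : 0 < x := by linarith
  have h1 := key (δ / (2 * x)) (by positivity) ((div_le_one (by positivity)).2 (by linarith))
  have h2 : (1 - δ / (2 * x)) * x = x - δ / 2 := by field_simp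
  linarith

end DualNorm

theorem mainTheorem2 {H : Type*} [NormedAddCommGroup H] [InnerProductSpace ℂ H]
    [FiniteDimensional ℂ H] [CompleteSpace H]
    (C : Set (H →L[ℂ] H)) (hC_psd : ∀ c ∈ C, 0 ≤ c)
    (hC_compact : IsCompact C) (hC_convex : Convex ℝ C)
    (hC_pos : ∃ c ∈ C, IsStrictlyPositive c)
    (p q p' q' : ℝ≥0∞) (hq' : 1 ≤ q') (hq'p' : q' ≤ p')
    (hp : p⁻¹ + p'⁻¹ = 1) (hq : q⁻¹ + q'⁻¹ = 1) :
    (∀ X : H →L[ℂ] H, 0 ≤ X →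
      IsLUB {t : ℝ | ∃ Y : H →L[ℂ] H, 0 ≤ Y ∧ supNorm C p q Y ≤ 1 ∧ t = ‖opTrace (X * Y)‖}
        (infNorm C p' q' X) ∧
      IsLUB {t : ℝ | ∃ Y : H →L[ℂ] H, supNorm C p q Y ≤ 1 ∧ t = ‖opTrace (X * Y)‖}
        (infNorm C p' q' X)) ∧
    (∀ X Y : H →L[ℂ] H, 0 ≤ X → 0 ≤ Y →
      infNorm C p' q' (X + Y) ≤ infNorm C p' q' X + infNorm C p' q' Y) := by
  have hinv := invDiff_eq_invDiff hp hq
  have hα : 0 ≤ invDiff p q := hinv ▸ invDiff_nonneg hq' hq'p'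
  have hαp : invDiff p q ≤ (p⁻¹).toReal := sub_le_self _ ENNReal.toReal_nonneg
  have hp1 : 1 ≤ p := one_le_of_inv_add_inv_eq_one hp
  have hpq : p ≤ q := by
    have hadd : p⁻¹ + p'⁻¹ = q⁻¹ + q'⁻¹ := hp.trans hq.symm
    by_contra! hlt
    have h1 : q⁻¹ ≠ ∞ := ne_top_of_le_ne_top ENNReal.one_ne_top (hq ▸ le_self_add)
    have h2 : p'⁻¹ ≠ ∞ := ne_top_of_le_ne_top ENNReal.one_ne_top (hp ▸ le_add_self)
    exact (ENNReal.add_lt_add_of_lt_of_le h2 (ENNReal.inv_lt_inv.2 hlt)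
      (ENNReal.inv_le_inv.2 hq'p')).ne hadd
  obtain ⟨c₀, hc₀, hpos₀⟩ := id hC_pos
  have hupper : ∀ X Y : H →L[ℂ] H, 0 ≤ X → supNorm C p q Y ≤ 1 →
      ‖opTrace (X * Y)‖ ≤ infNorm C p' q' X := by
    intro X Y hX hY
    refine le_csInf ⟨_, c₀, ⟨hc₀, hpos₀⟩, rfl⟩ ?_
    rintro _ ⟨c, ⟨hc, hpos⟩, rfl⟩
    have h1 : schattenNorm p (c ^ (invDiff p q / 2) * Y * c ^ (invDiff p q / 2)) ≤ 1 :=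
      (le_csSup (bddAbove_supNorm hC_compact hC_psd hp1 hpq Y) ⟨c, hc, rfl⟩).trans hY
    simp only [hinv]
    rw [← opTrace_rpow_conj_mul hpos (invDiff p q / 2)]
    refine (norm_opTrace_mul_le hp (rpow_conj_nonneg c _ hX) _).trans ?_
    exact mul_le_of_le_one_right (schattenNorm_nonneg _ _) h1
  have hwitness : ∀ X : H →L[ℂ] H, 0 ≤ X → ∀ t : ℝ, 0 < t → t < infNorm C p' q' X →
      ∃ Y : H →L[ℂ] H, 0 ≤ Y ∧ supNorm C p q Y ≤ 1 ∧ t ≤ ‖opTrace (X * Y)‖ := by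
    intro X hX t ht hlt
    obtain ⟨Y, hY, hfeas, htr⟩ := exists_nonneg_le_re_opTrace_mul hC_convex hC_pos hp hα hαp ht hX
      fun c hc hpos => by
        have h1 := csInf_le (bddBelow_infNorm C p' q' X) ⟨c, ⟨hc, hpos⟩, rfl⟩
        simp only [hinv] at h1
        refine lt_of_lt_of_le hlt (le_trans (le_of_eq ?_) h1)
        rw [infNorm, hinv]
    refine ⟨Y, hY, csSup_le ⟨_, c₀, hc₀, rfl⟩ ?_, htr.trans (Complex.re_le_norm _)⟩
    rintro _ ⟨c, hc, rfl⟩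
    exact schattenNorm_rpow_conj_le_one hC_psd hC_convex hC_pos hp hα hαp hY hfeas hc
  have hpos_lub : ∀ X : H →L[ℂ] H, 0 ≤ X → ∀ b : ℝ, (∀ Y : H →L[ℂ] H, 0 ≤ Y →
      supNorm C p q Y ≤ 1 → ‖opTrace (X * Y)‖ ≤ b) → infNorm C p' q' X ≤ b := by
    intro X hX b hb
    by_contra! hlt
    have hzero : supNorm C p q 0 ≤ 1 := by
      refine csSup_le ⟨_, c₀, hc₀, rfl⟩ ?_
      rintro _ ⟨c, hc, rfl⟩
      simp only [mul_zero, zero_mul, schattenNorm_zero hp1, zero_le_one]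
    have hb0 : 0 ≤ b := (norm_nonneg _).trans (hb 0 le_rfl hzero)
    obtain ⟨t, hbt, htX⟩ := exists_between hlt
    obtain ⟨Y, hY, hsup, hle⟩ := hwitness X hX t (hb0.trans_lt hbt) htX
    exact (hbt.trans_le hle).not_ge (hb Y hY hsup)
  have hlub : ∀ X : H →L[ℂ] H, 0 ≤ X →
      IsLUB {t : ℝ | ∃ Y : H →L[ℂ] H, 0 ≤ Y ∧ supNorm C p q Y ≤ 1 ∧ t = ‖opTrace (X * Y)‖}
        (infNorm C p' q' X) ∧
      IsLUB {t : ℝ | ∃ Y : H →L[ℂ] H, supNorm C p q Y ≤ 1 ∧ t = ‖opTrace (X * Y)‖}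
        (infNorm C p' q' X) := by
    intro X hX
    refine ⟨⟨?_, fun b hb => hpos_lub X hX b fun Y hY hsup => hb ⟨Y, hY, hsup, rfl⟩⟩,
      ⟨?_, fun b hb => hpos_lub X hX b fun Y _ hsup => hb ⟨Y, hsup, rfl⟩⟩⟩
    · rintro _ ⟨Y, _, hsup, rfl⟩
      exact hupper X Y hX hsup
    · rintro _ ⟨Y, hsup, rfl⟩
      exact hupper X Y hX hsup
  refine ⟨hlub, fun X Y hX hY => hpos_lub _ (add_nonneg hX hY) _ fun Z _ hsup => ?_⟩
  rw [add_mul, opTrace_add]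
  exact (norm_add_le _ _).trans (add_le_add (hupper X Z hX hsup) (hupper Y Z hY hsup))
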